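/- For an integer $n\ge 1$ let $\Omega(n)$ denote the number of prime factors of $n$ counted with repetition. For every integer $k\ge 1$ the series $$f_k=\sum_{\Omega(n)=k}\frac{1}{n\log n}$$ converges. The product over odd primes $$d=\frac14\prod_{p>2}\Big(1-\frac2p\Big)^{-1}\Big(1-\frac1p\Big)^{2}$$ converges, and $d=0.37869\cdots$, i.e. $0.37869\le d<0.37870$; in particular $d>0$. Moreover, there is an absolute constant $C$ such that for every integer $k\ge 1$ $$f_k = 1-\frac{\log 2}{4}\,2^{-k}\big(d\,k^2+E_k\big)\qquad\text{for some real } E_k \text{ with } |E_k|\le C\,k\log(k+1),$$ that is, $f_k = 1-\frac{\log 2}{4}2^{-k}\big(dk^2+O(k\log(k+1))\big)$ uniformly for $k\ge1$. -/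

import Mathlib

/-- The term `1 / (n log n)` attached to a `k`-almost prime `n`, i.e. a natural number with exactly
`k` prime factors counted with repetition. For `k ≥ 1` every such `n` is at least `2`. -/
noncomputable def erdosTerm (k : ℕ) (n : {n : ℕ // ArithmeticFunction.cardFactors n = k}) : ℝ :=
  1 / ((n : ℝ) * Real.log (n : ℝ))

/-- The Erdős sum `f_k` of the `k`-almost primes. -/
noncomputable def erdosSum (k : ℕ) : ℝ :=
  ∑' n : {n : ℕ // ArithmeticFunction.cardFactors n = k}, erdosTerm k n

/-- The Euler factor `(1 - 2/p)⁻¹ (1 - 1/p)²` at an odd prime `p`. -/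
noncomputable def oddEulerFactor (p : {p : ℕ // p.Prime ∧ 2 < p}) : ℝ :=
  (1 - 2 / (p : ℝ))⁻¹ * (1 - 1 / (p : ℝ)) ^ 2

/-- The constant `d = (1/4) ∏_{p > 2} (1 - 2/p)⁻¹ (1 - 1/p)²`, the product being over primes. -/
noncomputable def dConst : ℝ :=
  1 / 4 * ∏' p : {p : ℕ // p.Prime ∧ 2 < p}, oddEulerFactor p

/-! Since `1 / (n log n)` is the integral of `n ^ (-s)` over `s > 1`, the sum `f_k` is the integral
of `P_k(s) = ∑_{Ω(n) = k} n ^ (-s)`. The range `s > 2` contributes only `O(2 ^ (-k))`, so put `s = 1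
+ t` with `0 < t ≤ 1`. The generating function `∑ P_k(s) z ^ k = ∏_p (1 - z p ^ (-s))⁻¹` factors as
`(1 - 2 ^ (-1 - t) z)⁻¹ t ^ (-z) A_t(z)`, where `A_t(z) = t ^ z ∏_{p > 2} (1 - z p ^ (-1 - t))⁻¹`.
The factor `t ^ z` compensates the divergence of `∑ 1 / p`, so that `A_t` tends, with error `O(t)`,
to a power series `A = ∑ a_j z ^ j` that converges beyond `z = 2`. It satisfies `A(1) = 1 / 2`,
because `t ζ(1 + t) → 1`, and `A(2) = d` (`exists_limit_coeff`).

In the coefficient of `z ^ n` of the first two factors, replace `2 ^ (-i t)` by `1 - i t log 2`. As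
`t ^ c (-log t) ^ m / m!` has integral `(c + 1) ^ (-m - 1)` over `[0, 1]`, the result integrates to
`2 - 2 ^ (-n) - (log 2 / 4) 2 ^ (-n) n (n + 1)`. Convolving with `a_j`, the constant `2` yields `2
A(1) = 1`, and the last term yields `(log 2 / 4) 2 ^ (-k) A(2) k ^ 2` up to a relative error `O(1 /
k)`. The linearization costs `2 ^ (-k) O(k log (k + 1))` and replacing `A_t` by `A` costs `2 ^ (-k)
O(k)`.

No complex analysis enters. Newton's identity (`almostPrimeZeta_succ`) says that the formal
generating function solves a linear differential equation, hence so does `A_t`, and the coefficients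
of `A_t` and `A` are compared through the equation `A' = c A`
(`IsLogDerivSolution.abs_sub_mul_pow_le`). The value of `d` comes from extracting `ζ(2)` from the
product, which leaves factors `1 + O(p ^ (-3))`. -/

/-! ### Power series solutions of `A' = c A` -/

/-- `a` is the coefficient sequence of the solution of `A' = c A`, `A(0) = 1`. -/
structure IsLogDerivSolution (c a : ℕ → ℝ) : Prop where
  zero : a 0 = 1
  succ : ∀ n : ℕ, ((n : ℝ) + 1) * a (n + 1) =
    ∑ q ∈ Finset.HasAntidiagonal.antidiagonal n, c q.1 * a q.2

/-- The coefficient sequence of the solution of `A' = c A`, `A(0) = 1`. -/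
noncomputable def logDerivSolution (c : ℕ → ℝ) : ℕ → ℝ
  | 0 => 1
  | n + 1 => (∑ i : Fin (n + 1), c i * logDerivSolution c (n - i)) / ((n : ℝ) + 1)
decreasing_by omega

theorem isLogDerivSolution_logDerivSolution (c : ℕ → ℝ) :
    IsLogDerivSolution c (logDerivSolution c) := by
  refine ⟨by rw [logDerivSolution], fun n => ?_⟩
  rw [logDerivSolution, mul_div_cancel₀ _ (by positivity),
    Finset.Nat.sum_antidiagonal_eq_sum_range_succ (fun i j => c i * logDerivSolution c j),
    Finset.sum_range]

/-- A discrete Gronwall inequality. Passing from `n` to `n + 1` multiplies the bound by at most `(1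
+ Γ) / (n + 1)`, which is no longer a growth once `n ≥ Γ`; only boundedly many steps cost a factor
`1 + Γ`. -/
theorem le_of_convolution_le {u γ : ℕ → ℝ} {D Γ : ℝ} (hγ : ∀ n, 0 ≤ γ n)
    (hΓ : ∀ n, ∑ r ∈ Finset.range n, γ r ≤ Γ) (hD : 0 ≤ D) (h0 : u 0 ≤ D)
    (h : ∀ n : ℕ, ((n : ℝ) + 1) * u (n + 1) ≤
      D + ∑ q ∈ Finset.HasAntidiagonal.antidiagonal n, γ q.1 * u q.2) (n : ℕ) :
    u n ≤ D * (1 + Γ) ^ ⌈1 + Γ⌉₊ := by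
  have hΓ0 : 0 ≤ Γ := by simpa using hΓ 0
  set B := 1 + Γ with hB
  have hB1 : 1 ≤ B := by linarith
  set N := ⌈B⌉₊
  have hN : B ≤ N := Nat.le_ceil B
  -- The exponent stops growing at `N`, because for `n ≥ N ≥ B` the division by `n + 1` absorbs the
  -- new factor `B`.
  have key : ∀ n, u n ≤ D * B ^ (min n N) := by
    intro n
    induction n using Nat.strong_induction_on with
    | _ n ih =>
      rcases n with _ | n
      · simpa using h0
      · have h1 : ∑ q ∈ Finset.HasAntidiagonal.antidiagonal n, γ q.1 * u q.2 ≤ Γ * (D * B ^ min n N) := by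
          calc ∑ q ∈ Finset.HasAntidiagonal.antidiagonal n, γ q.1 * u q.2
              ≤ ∑ q ∈ Finset.HasAntidiagonal.antidiagonal n, γ q.1 * (D * B ^ min n N) := by
                refine Finset.sum_le_sum fun q hq => mul_le_mul_of_nonneg_left ?_ (hγ _)
                have hq' : q.2 ≤ n := by have := Finset.HasAntidiagonal.mem_antidiagonal.mp hq; omega
                refine (ih q.2 (by omega)).trans (mul_le_mul_of_nonneg_left ?_ hD)
                exact pow_le_pow_right₀ hB1 (by omega)
            _ = (∑ r ∈ Finset.range (n + 1), γ r) * (D * B ^ min n N) := by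
                rw [Finset.Nat.sum_antidiagonal_eq_sum_range_succ
                  (fun i _ => γ i * (D * B ^ min n N)), Finset.sum_mul]
            _ ≤ _ := mul_le_mul_of_nonneg_right (hΓ _) (by positivity)
        have h2 : ((n : ℝ) + 1) * u (n + 1) ≤ D * B ^ min n N * B := by
          have h3 : D ≤ D * B ^ min n N := le_mul_of_one_le_right hD (one_le_pow₀ hB1)
          have := h n
          rw [hB] at *
          nlinarith
        have hn0 : (0 : ℝ) < (n : ℝ) + 1 := by positivity
        rcases Nat.lt_or_ge n N with hlt | hge
        · rw [min_eq_left hlt.le] at h2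
          rw [min_eq_left (show n + 1 ≤ N from hlt), pow_succ, ← mul_assoc]
          rcases le_or_gt (u (n + 1)) 0 with hu | hu
          · exact hu.trans (by positivity)
          · exact le_trans (le_mul_of_one_le_left hu.le (by linarith [Nat.cast_nonneg (α := ℝ) n])) h2
        · rw [min_eq_right hge] at h2
          rw [min_eq_right (by omega : N ≤ n + 1)]
          have hBn : B ≤ (n : ℝ) + 1 := by
            have : (N : ℝ) ≤ n := by exact_mod_cast hge
            linarith
          have h4 : D * B ^ N * B ≤ ((n : ℝ) + 1) * (D * B ^ N) := by
            rw [mul_comm ((n : ℝ) + 1)]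
            exact mul_le_mul_of_nonneg_left hBn (by positivity)
          exact le_of_mul_le_mul_left (h2.trans h4) hn0
  refine (key n).trans (mul_le_mul_of_nonneg_left ?_ hD)
  exact pow_le_pow_right₀ hB1 (min_le_right _ _)

theorem antidiagonal_mul_pow (R : ℝ) (f g : ℕ → ℝ) (n : ℕ) :
    (∑ q ∈ Finset.HasAntidiagonal.antidiagonal n, f q.1 * g q.2) * R ^ n =
      ∑ q ∈ Finset.HasAntidiagonal.antidiagonal n, (f q.1 * R ^ q.1) * (g q.2 * R ^ q.2) := by
  rw [Finset.sum_mul]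
  refine Finset.sum_congr rfl fun q hq => ?_
  rw [← Finset.HasAntidiagonal.mem_antidiagonal.mp hq, pow_add]
  ring

theorem IsLogDerivSolution.abs_mul_pow_le {c a : ℕ → ℝ} (h : IsLogDerivSolution c a) {R Γ : ℝ}
    (hR : 0 < R) (hΓ : ∀ n, ∑ r ∈ Finset.range n, |c r| * R ^ r ≤ Γ) (n : ℕ) :
    |a n| * R ^ n ≤ (1 + R * Γ) ^ ⌈1 + R * Γ⌉₊ := by
  have := le_of_convolution_le (u := fun n => |a n| * R ^ n) (γ := fun n => R * (|c n| * R ^ n))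
    (D := 1) (Γ := R * Γ) (fun n => by positivity)
    (fun n => by rw [← Finset.mul_sum]; exact mul_le_mul_of_nonneg_left (hΓ n) hR.le)
    zero_le_one (by simp [h.zero]) (fun n => ?_) n
  · simpa using this
  · have h1 : ((n : ℝ) + 1) * |a (n + 1)| ≤
        ∑ q ∈ Finset.HasAntidiagonal.antidiagonal n, |c q.1| * |a q.2| := by
      have h2 : ((n : ℝ) + 1) * |a (n + 1)| = |((n : ℝ) + 1) * a (n + 1)| := by
        rw [abs_mul, abs_of_pos (by positivity : (0 : ℝ) < (n : ℝ) + 1)]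
      rw [h2, h.succ]
      refine (Finset.abs_sum_le_sum_abs _ _).trans (le_of_eq ?_)
      simp [abs_mul]
    have h3 := mul_le_mul_of_nonneg_right h1 (pow_nonneg hR.le n)
    rw [antidiagonal_mul_pow R (fun i => |c i|) (fun i => |a i|)] at h3
    have h4 := mul_le_mul_of_nonneg_left h3 hR.le
    rw [Finset.mul_sum] at h4
    simp only [mul_assoc] at h4 ⊢
    rw [pow_succ]
    linarith

/-- The difference satisfies the recursion with kernel `c'` and forcing term `(c' - c) * a`, so the
Gronwall bound is linear in `δ`. The extra factor `R` comes from the shift of index in the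
recursion. -/
theorem IsLogDerivSolution.abs_sub_mul_pow_le {c a c' a' : ℕ → ℝ} (h : IsLogDerivSolution c a)
    (h' : IsLogDerivSolution c' a') {R Γ δ M : ℝ} (hR : 0 < R) (hM0 : 0 ≤ M)
    (hΓ : ∀ n, ∑ r ∈ Finset.range n, |c' r| * R ^ r ≤ Γ)
    (hδ : ∀ n, ∑ r ∈ Finset.range n, |c' r - c r| * R ^ r ≤ δ)
    (hM : ∀ n, |a n| * R ^ n ≤ M) (n : ℕ) :
    |a' n - a n| * R ^ n ≤ R * δ * M * (1 + R * Γ) ^ ⌈1 + R * Γ⌉₊ := by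
  have hδ0 : 0 ≤ δ := by simpa using hδ 0
  refine le_of_convolution_le (u := fun n => |a' n - a n| * R ^ n)
    (γ := fun n => R * (|c' n| * R ^ n))
    (D := R * δ * M) (Γ := R * Γ) (fun n => by positivity)
    (fun n => by rw [← Finset.mul_sum]; exact mul_le_mul_of_nonneg_left (hΓ n) hR.le)
    (by positivity) (by simp only [h.zero, h'.zero]; simp; positivity) (fun n => ?_) n
  have h1 : ((n : ℝ) + 1) * |a' (n + 1) - a (n + 1)| ≤
      ∑ q ∈ Finset.HasAntidiagonal.antidiagonal n, |c' q.1 - c q.1| * |a q.2| +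
      ∑ q ∈ Finset.HasAntidiagonal.antidiagonal n, |c' q.1| * |a' q.2 - a q.2| := by
    have h2 : ((n : ℝ) + 1) * |a' (n + 1) - a (n + 1)| =
        |((n : ℝ) + 1) * a' (n + 1) - ((n : ℝ) + 1) * a (n + 1)| := by
      rw [← mul_sub, abs_mul, abs_of_pos (by positivity : (0 : ℝ) < (n : ℝ) + 1)]
    rw [h2, h.succ, h'.succ, ← Finset.sum_sub_distrib, ← Finset.sum_add_distrib]
    refine (Finset.abs_sum_le_sum_abs _ _).trans (Finset.sum_le_sum fun q _ => ?_)
    rw [← abs_mul, ← abs_mul]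
    refine le_trans (le_of_eq ?_) (abs_add_le _ _)
    congr 1
    ring
  have h3 := mul_le_mul_of_nonneg_right h1 (pow_nonneg hR.le n)
  rw [add_mul (Finset.sum _ _), antidiagonal_mul_pow R (fun i => |c' i - c i|) (fun i => |a i|),
    antidiagonal_mul_pow R (fun i => |c' i|) (fun i => |a' i - a i|)] at h3
  have h5 : ∑ q ∈ Finset.HasAntidiagonal.antidiagonal n, |c' q.1 - c q.1| * R ^ q.1 * (|a q.2| * R ^ q.2)
      ≤ δ * M := by
    calc _ ≤ ∑ q ∈ Finset.HasAntidiagonal.antidiagonal n, |c' q.1 - c q.1| * R ^ q.1 * M :=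
          Finset.sum_le_sum fun q _ => mul_le_mul_of_nonneg_left (hM _) (by positivity)
      _ = (∑ r ∈ Finset.range (n + 1), |c' r - c r| * R ^ r) * M := by
          rw [Finset.Nat.sum_antidiagonal_eq_sum_range_succ
            (fun i _ => |c' i - c i| * R ^ i * M), Finset.sum_mul]
      _ ≤ _ := mul_le_mul_of_nonneg_right (hδ _) hM0
  have h4 := mul_le_mul_of_nonneg_left (h3.trans (add_le_add_left h5 _)) hR.le
  rw [mul_add, Finset.mul_sum] at h4
  simp only [mul_assoc] at h4 ⊢
  rw [pow_succ]
  linarith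

theorem hasDerivAt_tsum_mul_pow {a : ℕ → ℝ} {ρ : ℝ} (hρ : 0 < ρ)
    (ha : Summable fun n : ℕ => ((n : ℝ) + 1) * |a (n + 1)| * ρ ^ n) {z : ℝ} (hz : |z| < ρ) :
    HasDerivAt (fun z => ∑' n, a n * z ^ n) (∑' n : ℕ, ((n : ℝ) + 1) * a (n + 1) * z ^ n) z := by
  have hu : Summable fun n : ℕ => |a n| * (n * ρ ^ (n - 1)) := by
    rw [← summable_nat_add_iff 1]
    refine ha.congr fun n => ?_
    simp only [Nat.add_sub_cancel, Nat.cast_add, Nat.cast_one]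
    ring
  have hb : ∀ n, ∀ y ∈ Metric.ball (0 : ℝ) ρ, ‖a n * (n * y ^ (n - 1))‖ ≤
      |a n| * (n * ρ ^ (n - 1)) := by
    intro n y hy
    have hy' : |y| ≤ ρ := by
      have := mem_ball_zero_iff.mp hy
      exact this.le
    rw [norm_mul, norm_mul, norm_pow, Real.norm_eq_abs, Real.norm_eq_abs, Real.norm_eq_abs,
      abs_of_nonneg (Nat.cast_nonneg (α := ℝ) n)]
    gcongr
  have h0 : Summable fun n => a n * (0 : ℝ) ^ n :=
    summable_of_ne_finset_zero (s := {0}) fun n hn => by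
      simp at hn
      simp [hn]
  have hz' : z ∈ Metric.ball (0 : ℝ) ρ := by simpa using hz
  have key := hasDerivAt_tsum_of_isPreconnected hu Metric.isOpen_ball
    (convex_ball (0 : ℝ) ρ).isPreconnected
    (g := fun n y => a n * y ^ n) (g' := fun n y => a n * (n * y ^ (n - 1)))
    (fun n y _ => (hasDerivAt_pow n y).const_mul (a n)) hb (y₀ := 0) (by simpa using hρ) h0 hz'
  have hs : Summable fun n => a n * (n * z ^ (n - 1)) :=
    Summable.of_norm_bounded hu fun n => hb n z hz'
  have h1 : ∑' n, a n * (n * z ^ (n - 1)) = ∑' n : ℕ, ((n : ℝ) + 1) * a (n + 1) * z ^ n := by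
    rw [hs.tsum_eq_zero_add]
    simp only [Nat.cast_zero, zero_mul, mul_zero, zero_add, Nat.cast_add, Nat.cast_one,
      Nat.add_sub_cancel]
    exact tsum_congr fun n => by ring
  rw [← h1]
  exact key

/-- With `Φ` the antiderivative of `c`, the function `A exp(-Φ)` has derivative zero, so it keeps
its value `1` at the origin. -/
theorem IsLogDerivSolution.tsum_mul_pow_eq_exp {c a : ℕ → ℝ} (h : IsLogDerivSolution c a) {ρ : ℝ}
    (hρ : 0 < ρ) (ha : Summable fun n : ℕ => ((n : ℝ) + 1) * |a (n + 1)| * ρ ^ n)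
    (hc : Summable fun n : ℕ => |c n| * ρ ^ n) {z : ℝ} (hz0 : 0 ≤ z) (hz : z < ρ) :
    ∑' n, a n * z ^ n = Real.exp (∑' n : ℕ, c n / ((n : ℝ) + 1) * z ^ (n + 1)) := by
  set b : ℕ → ℝ := fun n => if n = 0 then 0 else c (n - 1) / n with hb
  have hbs : Summable fun n : ℕ => ((n : ℝ) + 1) * |b (n + 1)| * ρ ^ n := by
    refine hc.congr fun n => ?_
    have hn : (0 : ℝ) < (n : ℝ) + 1 := by positivity
    simp only [hb, Nat.add_eq_zero_iff, one_ne_zero, and_false, if_false, Nat.add_sub_cancel,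
      Nat.cast_add, Nat.cast_one, abs_div, abs_of_pos hn]
    field_simp
  set A : ℝ → ℝ := fun z => ∑' n, a n * z ^ n
  set Φ : ℝ → ℝ := fun z => ∑' n, b n * z ^ n
  have hsum_of : ∀ {f : ℕ → ℝ}, (Summable fun n : ℕ => |f n| * ρ ^ n) → ∀ {y : ℝ}, |y| < ρ →
      Summable fun n => ‖f n * y ^ n‖ := by
    intro f hf y hy
    refine hf.of_nonneg_of_le (fun n => norm_nonneg _) fun n => ?_
    rw [norm_mul, norm_pow, Real.norm_eq_abs, Real.norm_eq_abs]
    gcongr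
  have hA : ∀ y, |y| < ρ → HasDerivAt A ((∑' n, c n * y ^ n) * A y) y := by
    intro y hy
    convert hasDerivAt_tsum_mul_pow hρ ha hy using 1
    have hsa : Summable fun n => |a n| * ρ ^ n := by
      rw [← summable_nat_add_iff 1]
      refine (ha.mul_left ρ).of_nonneg_of_le (fun n => by positivity) fun n => ?_
      rw [pow_succ]
      have : 0 ≤ (n : ℝ) * |a (n + 1)| * ρ ^ n * ρ := by positivity
      linarith
    rw [tsum_mul_tsum_eq_tsum_sum_antidiagonal_of_summable_norm (hsum_of hc hy) (hsum_of hsa hy)]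
    refine tsum_congr fun n => ?_
    rw [h.succ, antidiagonal_mul_pow]
  have hΦ : ∀ y, |y| < ρ → HasDerivAt Φ (∑' n, c n * y ^ n) y := by
    intro y hy
    convert hasDerivAt_tsum_mul_pow hρ hbs hy using 1
    refine tsum_congr fun n => ?_
    have hn : (n : ℝ) + 1 ≠ 0 := by positivity
    simp only [hb, Nat.add_eq_zero_iff, one_ne_zero, and_false, if_false, Nat.add_sub_cancel,
      Nat.cast_add, Nat.cast_one]
    field_simp
  have hconst : ∀ y ∈ Set.Icc (0 : ℝ) z,
      A y * Real.exp (-Φ y) = A 0 * Real.exp (-Φ 0) := by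
    have hlt : ∀ y ∈ Set.Icc (0 : ℝ) z, |y| < ρ := fun y hy => by
      rw [abs_of_nonneg hy.1]; exact hy.2.trans_lt hz
    have hd : ∀ y ∈ Set.Icc (0 : ℝ) z,
        HasDerivAt (fun y => A y * Real.exp (-Φ y)) 0 y := fun y hy => by
      refine ((hA y (hlt y hy)).fun_mul ((hΦ y (hlt y hy)).fun_neg.exp)).congr_deriv ?_
      ring
    exact constant_of_has_deriv_right_zero
      (fun y hy => (hd y hy).continuousAt.continuousWithinAt)
      (fun y hy => (hd y ⟨hy.1, hy.2.le⟩).hasDerivWithinAt)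
  have h1 := hconst z ⟨hz0, le_rfl⟩
  have hA0 : A 0 = 1 := by
    change ∑' n, a n * (0 : ℝ) ^ n = 1
    rw [tsum_eq_single 0 (fun n hn => by simp [hn])]
    simp [h.zero]
  have hΦ0 : Φ 0 = 0 := by
    change ∑' n, b n * (0 : ℝ) ^ n = 0
    rw [tsum_eq_single 0 (fun n hn => by simp [hn])]
    simp [hb]
  have hΦz : Φ z = ∑' n : ℕ, c n / ((n : ℝ) + 1) * z ^ (n + 1) := by
    have hsb : Summable fun n => b n * z ^ n := by
      have : Summable fun n => |b n| * ρ ^ n := by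
        rw [← summable_nat_add_iff 1]
        refine (hbs.mul_left ρ).of_nonneg_of_le (fun n => by positivity) fun n => ?_
        rw [pow_succ]
        have : 0 ≤ (n : ℝ) * |b (n + 1)| * ρ ^ n * ρ := by positivity
        linarith
      exact (hsum_of this (by rwa [abs_of_nonneg hz0])).of_norm
    simp only [Φ]
    rw [hsb.tsum_eq_zero_add]
    simp [hb]
  rw [hA0, hΦ0, neg_zero, Real.exp_zero, mul_one, Real.exp_neg, hΦz] at h1
  have := Real.exp_pos (∑' n : ℕ, c n / ((n : ℝ) + 1) * z ^ (n + 1))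
  rwa [mul_inv_eq_iff_eq_mul₀ this.ne', one_mul] at h1

/-! ### Newton's identity for the almost prime zeta functions -/

/-- The Dirichlet series `∑ n ^ (-s)` over the `k`-almost primes. -/
noncomputable def almostPrimeZeta (k : ℕ) (s : ℝ) : ℝ :=
  ∑' n : {n : ℕ // ArithmeticFunction.cardFactors n = k}, ((n : ℕ) : ℝ) ^ (-s)

/-- The sum `∑ p ^ (-r s)` over all primes. -/
noncomputable def primePowerSum (r : ℕ) (s : ℝ) : ℝ :=
  ∑' p : Nat.Primes, (((p : ℕ) : ℝ) ^ (-s)) ^ r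

theorem tsum_subtype_eq_tsum_ite {α : Type*} [AddCommMonoid α] [TopologicalSpace α]
    (P : ℕ → Prop) [DecidablePred P] (f : ℕ → α) :
    ∑' n : {n : ℕ // P n}, f n = ∑' n, if P n then f n else 0 := by
  rw [← (Subtype.val_injective (p := P)).tsum_eq]
  · exact tsum_congr fun n => (if_pos n.2).symm
  · intro n hn
    have : P n := by
      by_contra h
      simp [h] at hn
    exact ⟨⟨n, this⟩, rfl⟩

theorem summable_nat_rpow_neg {s : ℝ} (hs : 1 < s) : Summable fun n : ℕ => (n : ℝ) ^ (-s) :=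
  Real.summable_nat_rpow.mpr (by linarith)

theorem summable_almostPrime_rpow (k : ℕ) {s : ℝ} (hs : 1 < s) :
    Summable fun n : {n : ℕ // ArithmeticFunction.cardFactors n = k} => ((n : ℕ) : ℝ) ^ (-s) :=
  (summable_nat_rpow_neg hs).subtype _

theorem prime_rpow_le_one (p : Nat.Primes) {s : ℝ} (hs : 0 ≤ s) : ((p : ℕ) : ℝ) ^ (-s) ≤ 1 :=
  Real.rpow_le_one_of_one_le_of_nonpos (by exact_mod_cast p.2.one_lt.le) (by linarith)

theorem summable_primePower (r : ℕ) {s : ℝ} (hs : 1 < s) :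
    Summable fun p : Nat.Primes => (((p : ℕ) : ℝ) ^ (-s)) ^ (r + 1) := by
  refine ((summable_nat_rpow_neg hs).subtype _).of_nonneg_of_le (fun p => by positivity)
    fun (p : Nat.Primes) => ?_
  exact pow_le_of_le_one (by positivity) (prime_rpow_le_one p (by linarith)) (by omega)

theorem almostPrimeZeta_nonneg (k : ℕ) (s : ℝ) : 0 ≤ almostPrimeZeta k s :=
  tsum_nonneg fun _ => by positivity

theorem almostPrimeZeta_zero {s : ℝ} (hs : 1 < s) : almostPrimeZeta 0 s = 1 := by
  unfold almostPrimeZeta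
  rw [tsum_eq_single ⟨1, by simp⟩]
  · simp
  · rintro ⟨n, hn⟩ hne
    -- `cardFactors 0 = 0`, so `0` is also indexed here; it contributes `0 ^ (-s) = 0`.
    have : n = 0 ∨ n = 1 := by simpa using hn
    rcases this with rfl | rfl
    · simp [Real.zero_rpow (by linarith : -s ≠ 0)]
    · exact absurd rfl hne

/-- Writing `Ω(n)` as a count of prime powers dividing `n` prepares a double counting. Values in
`ENNReal` let the sums be interchanged freely. -/
theorem cardFactors_eq_tsum {n : ℕ} (hn : n ≠ 0) :
    (ArithmeticFunction.cardFactors n : ENNReal) =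
      ∑' p : Nat.Primes, ∑' r : ℕ, if (p : ℕ) ^ (r + 1) ∣ n then 1 else 0 := by
  have h1 : ∀ p : Nat.Primes, (∑' r : ℕ, if (p : ℕ) ^ (r + 1) ∣ n then (1 : ENNReal) else 0) =
      (n.factorization p : ENNReal) := by
    intro p
    rw [tsum_eq_sum (s := Finset.range (n.factorization p))]
    · rw [Finset.sum_congr rfl (g := fun _ => 1)]
      · simp
      · intro r hr
        rw [if_pos]
        exact (p.2.pow_dvd_iff_le_factorization hn).mpr (Finset.mem_range.mp hr)
    · intro r hr
      rw [if_neg]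
      rw [p.2.pow_dvd_iff_le_factorization hn]
      simpa using hr
  simp_rw [h1]
  rw [ArithmeticFunction.cardFactors_eq_sum_factorization, Finsupp.sum]
  refine Eq.trans ?_ (tsum_subtype_eq_tsum_ite Nat.Prime
    (fun p : ℕ => (n.factorization p : ENNReal))).symm
  rw [tsum_eq_sum (s := n.factorization.support)]
  · push_cast
    refine Finset.sum_congr rfl fun p hp => ?_
    rw [if_pos]
    exact Nat.prime_of_mem_primeFactors (by simpa using hp)
  · intro p hp
    rw [Finsupp.notMem_support_iff] at hp
    simp [hp]

/-- Substitute `n = p ^ (r + 1) * m`, where `Ω(m) = k - r`; no such `m` exists when `r > k`. -/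
theorem tsum_almostPrime_dvd (k r : ℕ) (p : Nat.Primes) {s : ℝ} (hs : 1 < s) :
    (∑' n : ℕ, if ArithmeticFunction.cardFactors n = k + 1 ∧ (p : ℕ) ^ (r + 1) ∣ n then
        ENNReal.ofReal ((n : ℝ) ^ (-s)) else 0) =
      if r ≤ k then ENNReal.ofReal ((((p : ℕ) : ℝ) ^ (-s)) ^ (r + 1)) *
        ENNReal.ofReal (almostPrimeZeta (k - r) s) else 0 := by
  set d : ℕ := (p : ℕ) ^ (r + 1) with hd
  have hd0 : d ≠ 0 := pow_ne_zero _ p.2.ne_zero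
  have hinj : Function.Injective (fun m : ℕ => d * m) := fun a b h =>
    Nat.eq_of_mul_eq_mul_left (Nat.pos_of_ne_zero hd0) h
  have h0 : (0 : ℝ) ^ (-s) = 0 := Real.zero_rpow (by linarith)
  have hΩ : ∀ m : ℕ, m ≠ 0 → ArithmeticFunction.cardFactors (d * m) =
      r + 1 + ArithmeticFunction.cardFactors m := by
    intro m hm
    rw [ArithmeticFunction.cardFactors_mul hd0 hm, hd,
      ArithmeticFunction.cardFactors_apply_prime_pow p.2]
  have hrp : ((d : ℕ) : ℝ) ^ (-s) = (((p : ℕ) : ℝ) ^ (-s)) ^ (r + 1) := by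
    rw [hd, Nat.cast_pow, ← Real.rpow_natCast, ← Real.rpow_natCast, ← Real.rpow_mul (by positivity),
      ← Real.rpow_mul (by positivity), mul_comm]
  rw [← hinj.tsum_eq]
  · have h1 : ∀ m : ℕ, (if ArithmeticFunction.cardFactors (d * m) = k + 1 ∧ d ∣ d * m then
        ENNReal.ofReal (((d * m : ℕ) : ℝ) ^ (-s)) else 0) =
        if r ≤ k then ENNReal.ofReal ((((p : ℕ) : ℝ) ^ (-s)) ^ (r + 1)) *
          (if ArithmeticFunction.cardFactors m = k - r then
            ENNReal.ofReal ((m : ℝ) ^ (-s)) else 0) else 0 := by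
      intro m
      rcases eq_or_ne m 0 with rfl | hm
      · simp [h0]
      · rw [hΩ m hm]
        by_cases hrk : r ≤ k
        · rw [if_pos hrk, mul_ite, mul_zero, Nat.cast_mul,
            Real.mul_rpow (by positivity) (by positivity), hrp, ENNReal.ofReal_mul (by positivity)]
          refine if_congr ?_ rfl rfl
          simp only [dvd_mul_right, and_true]
          omega
        · rw [if_neg hrk, if_neg]
          omega
    rw [tsum_congr h1]
    by_cases hrk : r ≤ k
    · simp only [if_pos hrk]
      rw [ENNReal.tsum_mul_left, ← tsum_subtype_eq_tsum_ite
        (fun n => ArithmeticFunction.cardFactors n = k - r)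
          (fun m : ℕ => ENNReal.ofReal ((m : ℝ) ^ (-s))), almostPrimeZeta,
        ENNReal.ofReal_tsum_of_nonneg (fun _ => by positivity) (summable_almostPrime_rpow _ hs)]
    · simp [hrk]
  · intro n hn
    simp only [Function.mem_support, ne_eq, ite_eq_right_iff, Classical.not_imp] at hn
    obtain ⟨m, hm⟩ := hn.1.2
    exact ⟨m, hm.symm⟩

/-- Weight each `n` with `Ω(n) = k + 1` by `Ω(n)`, expand the weight as the number of prime powers
dividing `n`, and sum over the prime powers first. This is Newton's identity between complete
homogeneous and power sums in the variables `p ^ (-s)`. -/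
theorem almostPrimeZeta_succ (k : ℕ) {s : ℝ} (hs : 1 < s) :
    ((k : ℝ) + 1) * almostPrimeZeta (k + 1) s =
      ∑ q ∈ Finset.HasAntidiagonal.antidiagonal k,
        primePowerSum (q.1 + 1) s * almostPrimeZeta q.2 s := by
  have hp0 : ∀ r, 0 ≤ primePowerSum r s := fun r => tsum_nonneg fun _ => by positivity
  have hL : ENNReal.ofReal (((k : ℝ) + 1) * almostPrimeZeta (k + 1) s) =
      ∑' n : ℕ, ∑' p : Nat.Primes, ∑' r : ℕ,
        if ArithmeticFunction.cardFactors n = k + 1 ∧ (p : ℕ) ^ (r + 1) ∣ n then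
          ENNReal.ofReal ((n : ℝ) ^ (-s)) else 0 := by
    rw [ENNReal.ofReal_mul (by positivity), almostPrimeZeta,
      ENNReal.ofReal_tsum_of_nonneg (fun _ => by positivity) (summable_almostPrime_rpow _ hs),
      ← ENNReal.tsum_mul_left]
    refine (tsum_subtype_eq_tsum_ite (fun n => ArithmeticFunction.cardFactors n = k + 1)
      (fun n : ℕ => ENNReal.ofReal ((k : ℝ) + 1) * ENNReal.ofReal ((n : ℝ) ^ (-s)))).trans ?_
    refine tsum_congr fun n => ?_
    by_cases hn : ArithmeticFunction.cardFactors n = k + 1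
    · have hn0 : n ≠ 0 := by
        rintro rfl
        simp at hn
      rw [if_pos hn]
      have h1 : ENNReal.ofReal ((k : ℝ) + 1) = (ArithmeticFunction.cardFactors n : ENNReal) := by
        rw [hn, ← ENNReal.ofReal_natCast]
        push_cast
        rfl
      rw [h1, cardFactors_eq_tsum hn0, ← ENNReal.tsum_mul_right]
      refine tsum_congr fun p => ?_
      rw [← ENNReal.tsum_mul_right]
      refine tsum_congr fun r => ?_
      simp [hn]
    · simp [hn]
  have hR : ENNReal.ofReal (((k : ℝ) + 1) * almostPrimeZeta (k + 1) s) =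
      ENNReal.ofReal (∑ q ∈ Finset.HasAntidiagonal.antidiagonal k,
        primePowerSum (q.1 + 1) s * almostPrimeZeta q.2 s) := by
    rw [hL, ENNReal.tsum_comm]
    have h2 : ∀ p : Nat.Primes, (∑' n : ℕ, ∑' r : ℕ,
        if ArithmeticFunction.cardFactors n = k + 1 ∧ (p : ℕ) ^ (r + 1) ∣ n then
          ENNReal.ofReal ((n : ℝ) ^ (-s)) else 0) =
        ∑' r : ℕ, if r ≤ k then ENNReal.ofReal ((((p : ℕ) : ℝ) ^ (-s)) ^ (r + 1)) *
          ENNReal.ofReal (almostPrimeZeta (k - r) s) else 0 := by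
      intro p
      rw [ENNReal.tsum_comm]
      exact tsum_congr fun r => tsum_almostPrime_dvd k r p hs
    rw [tsum_congr h2, ENNReal.tsum_comm,
      tsum_eq_sum (s := Finset.range (k + 1)) (fun r hr => by
        have : ¬ r ≤ k := by simpa using hr
        simp [this]),
      Finset.Nat.sum_antidiagonal_eq_sum_range_succ
        (fun i j => primePowerSum (i + 1) s * almostPrimeZeta j s),
      ENNReal.ofReal_sum_of_nonneg
        (fun r _ => mul_nonneg (hp0 _) (almostPrimeZeta_nonneg _ _))]
    refine Finset.sum_congr rfl fun r hr => ?_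
    have : r ≤ k := by simpa [Nat.lt_succ_iff] using hr
    simp only [this, if_true]
    rw [ENNReal.tsum_mul_right, ENNReal.ofReal_mul (hp0 _), primePowerSum,
      ENNReal.ofReal_tsum_of_nonneg (fun _ => by positivity) (summable_primePower r hs)]
  refine (ENNReal.ofReal_eq_ofReal_iff (mul_nonneg (by positivity) (almostPrimeZeta_nonneg _ _))
    (Finset.sum_nonneg fun q _ => mul_nonneg (hp0 _) (almostPrimeZeta_nonneg _ _))).mp hR

/-! ### Odd primes, the Euler product and the logarithmic series -/

/-- The odd primes. -/
abbrev OddPrime : Type := {p : ℕ // p.Prime ∧ 2 < p}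

theorem tsum_primes_eq_add_tsum_oddPrime (f : ℕ → ℝ) (hf : Summable fun p : Nat.Primes => f p) :
    ∑' p : Nat.Primes, f p = f 2 + ∑' p : OddPrime, f p := by
  have h1 : ∑' p : Nat.Primes, f p = ∑' n : ℕ, if n.Prime then f n else 0 :=
    tsum_subtype_eq_tsum_ite Nat.Prime f
  have h2 : Summable fun n : ℕ => if n.Prime then f n else 0 := by
    refine (Subtype.val_injective (p := Nat.Prime)).summable_iff (fun n hn => ?_) |>.mp ?_
    · rw [if_neg]
      exact fun h => hn ⟨⟨n, h⟩, rfl⟩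
    · exact hf.congr fun p => (if_pos p.2).symm
  rw [h1, h2.tsum_eq_add_tsum_ite 2, if_pos Nat.prime_two,
    tsum_subtype_eq_tsum_ite (fun p => p.Prime ∧ 2 < p) f]
  congr 1
  refine tsum_congr fun n => ?_
  by_cases hn : n = 2
  · simp [hn]
  · by_cases hp : n.Prime
    · have := hp.two_le
      simp [hn, hp, show 2 < n by omega]
    · simp [hp]

theorem summable_oddPrime {f : ℕ → ℝ} (hf : Summable f) : Summable fun p : OddPrime => f p :=
  hf.comp_injective Subtype.val_injective

theorem OddPrime.three_le (p : OddPrime) : (3 : ℝ) ≤ (p : ℕ) := by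
  exact_mod_cast p.2.2

/-- The map `n ↦ n ^ (-s)` as a monoid-with-zero homomorphism. -/
noncomputable def rpowNegHom (s : ℝ) (hs : s ≠ 0) : ℕ →*₀ ℝ where
  toFun n := (n : ℝ) ^ (-s)
  map_zero' := by simp [Real.zero_rpow (neg_ne_zero.mpr hs)]
  map_one' := by simp
  map_mul' m n := by
    push_cast
    exact Real.mul_rpow (by positivity) (by positivity)

theorem hasProd_one_sub_prime_rpow {s : ℝ} (hs : 1 < s) :
    HasProd (fun p : Nat.Primes => (1 - ((p : ℕ) : ℝ) ^ (-s))⁻¹) (∑' n : ℕ, (n : ℝ) ^ (-s)) :=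
  EulerProduct.eulerProduct_completely_multiplicative_hasProd
    (f := rpowNegHom s (by linarith)) (summable_nat_rpow_neg hs).norm

theorem prime_rpow_le_half (p : Nat.Primes) {s : ℝ} (hs : 1 ≤ s) :
    ((p : ℕ) : ℝ) ^ (-s) ≤ 1 / 2 := by
  have hp : (2 : ℝ) ≤ (p : ℕ) := by exact_mod_cast p.2.two_le
  calc ((p : ℕ) : ℝ) ^ (-s) ≤ (2 : ℝ) ^ (-s) :=
        Real.rpow_le_rpow_of_nonpos (by norm_num) hp (by linarith)
    _ ≤ (2 : ℝ) ^ (-1 : ℝ) := Real.rpow_le_rpow_of_exponent_le (by norm_num) (by linarith)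
    _ = 1 / 2 := by rw [Real.rpow_neg_one]; norm_num

/-- The tail `∑_{r ≥ 2} x ^ r / r` of the logarithmic series. -/
noncomputable def logTail (x : ℝ) : ℝ := -Real.log (1 - x) - x

theorem logTail_nonneg {x : ℝ} (hx : x < 1) : 0 ≤ logTail x := by
  have := Real.log_le_sub_one_of_pos (by linarith : 0 < 1 - x)
  unfold logTail
  linarith

theorem logTail_le {x : ℝ} (hx1 : x ≤ 2 / 3) : logTail x ≤ 3 * x ^ 2 := by
  have h0 : 0 < 1 - x := by linarith
  have h := Real.one_sub_inv_le_log_of_pos h0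
  have h1 : logTail x ≤ (1 - x)⁻¹ - 1 - x := by unfold logTail; linarith
  have h2 : (1 - x)⁻¹ - 1 - x = x ^ 2 / (1 - x) := by field_simp; ring
  rw [h2] at h1
  refine h1.trans ?_
  rw [div_le_iff₀ h0]
  nlinarith [sq_nonneg x]

theorem abs_logTail_sub_le {x y : ℝ} (hyx : y ≤ x) (hx0 : 0 ≤ x) (hx : x ≤ 1 / 2) (hy : 0 ≤ y) :
    |logTail y - logTail x| ≤ 2 * x * (x - y) := by
  have hx1 : 0 < 1 - x := by linarith
  have hy1 : 0 < 1 - y := by linarith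
  have hlog : logTail x - logTail y = Real.log ((1 - y) / (1 - x)) - (x - y) := by
    rw [Real.log_div hy1.ne' hx1.ne']
    unfold logTail
    ring
  have hq : 0 < (1 - y) / (1 - x) := div_pos hy1 hx1
  have h1 := Real.log_le_sub_one_of_pos hq
  have h2 := Real.one_sub_inv_le_log_of_pos hq
  have h3 : (1 - y) / (1 - x) - 1 = (x - y) / (1 - x) := by field_simp; ring
  have h4 : 1 - ((1 - y) / (1 - x))⁻¹ = (x - y) / (1 - y) := by
    rw [inv_div]; field_simp; ring
  rw [h3] at h1
  rw [h4] at h2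
  have h5 : x - y ≤ (x - y) / (1 - y) := by
    rw [le_div_iff₀ hy1]
    nlinarith
  have h6 : (x - y) / (1 - x) ≤ (x - y) + 2 * x * (x - y) := by
    rw [div_le_iff₀ hx1]
    nlinarith [mul_nonneg (mul_nonneg hx0 (sub_nonneg.mpr hyx)) (by linarith : 0 ≤ 1 - 2 * x)]
  rw [abs_sub_comm, hlog, abs_of_nonneg (by linarith)]
  linarith

theorem summable_log_primes {s : ℝ} (hs : 1 < s) :
    Summable fun p : Nat.Primes => -Real.log (1 - ((p : ℕ) : ℝ) ^ (-s)) := by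
  have h1 : Summable fun p : Nat.Primes => ((p : ℕ) : ℝ) ^ (-s) := by
    simpa using summable_primePower 0 hs
  have h2 := (h1.mul_left 2)
  refine h2.of_nonneg_of_le (fun p => ?_) (fun p => ?_)
  · have : 0 ≤ ((p : ℕ) : ℝ) ^ (-s) := by positivity
    have h3 := prime_rpow_le_half p hs.le
    have := Real.log_nonpos (by linarith : 0 ≤ 1 - ((p : ℕ) : ℝ) ^ (-s)) (by linarith)
    linarith
  · have h0 : 0 ≤ ((p : ℕ) : ℝ) ^ (-s) := by positivity
    have h3 := prime_rpow_le_half p hs.le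
    have h4 := abs_logTail_sub_le h0 h0 h3 le_rfl
    have h5 := (abs_le.mp h4).1
    have h6 : logTail 0 = 0 := by simp [logTail]
    rw [h6, logTail] at h5
    nlinarith

theorem log_zeta_eq {s : ℝ} (hs : 1 < s) :
    ∑' p : Nat.Primes, -Real.log (1 - ((p : ℕ) : ℝ) ^ (-s)) =
      Real.log (∑' n : ℕ, (n : ℝ) ^ (-s)) := by
  have hpos : ∀ p : Nat.Primes, 0 < (1 - ((p : ℕ) : ℝ) ^ (-s))⁻¹ := fun p => by
    have h3 := prime_rpow_le_half p hs.le
    exact inv_pos.mpr (by linarith)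
  have hsum : Summable fun p : Nat.Primes => Real.log (1 - ((p : ℕ) : ℝ) ^ (-s))⁻¹ :=
    (summable_log_primes hs).congr fun p => (Real.log_inv _).symm
  rw [← (hasProd_one_sub_prime_rpow hs).tprod_eq, ← Real.rexp_tsum_eq_tprod hpos hsum,
    Real.log_exp]
  exact tsum_congr fun p => (Real.log_inv _).symm

/-! ### The size of `ζ(1 + t)` near `t = 0` -/

theorem one_sub_rpow_neg_le {x t : ℝ} (hx : 0 < x) : 1 - x ^ (-t) ≤ t * Real.log x := by
  rw [Real.rpow_def_of_pos hx]
  have := Real.add_one_le_exp (Real.log x * -t)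
  linarith

/-- The convex function `x ^ (-t)` lies above its tangents. Used with `y = x + 1` and with `y = x -
1`, this bounds `t n ^ (-1 - t)` from both sides by telescoping differences. -/
theorem rpow_neg_tangent {x y t : ℝ} (hx : 0 < x) (hy : 0 < y) (ht : 0 ≤ t) :
    x ^ (-t) - t * x ^ (-(1 + t)) * (y - x) ≤ y ^ (-t) := by
  have h1 := one_sub_rpow_neg_le (t := t) (div_pos hy hx)
  have h2 := mul_le_mul_of_nonneg_left (Real.log_le_sub_one_of_pos (div_pos hy hx)) ht
  rw [Real.div_rpow hy.le hx.le] at h1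
  have hx' : 0 < x ^ (-t) := Real.rpow_pos_of_pos hx _
  have h3 : x ^ (-(1 + t)) = x ^ (-t) / x := by
    rw [neg_add, add_comm, Real.rpow_add hx, Real.rpow_neg_one]
    rfl
  have h4 : 1 - y ^ (-t) / x ^ (-t) ≤ t * (y / x - 1) := h1.trans h2
  have h5 := mul_le_mul_of_nonneg_left h4 hx'.le
  have h6 : x ^ (-t) * (1 - y ^ (-t) / x ^ (-t)) = x ^ (-t) - y ^ (-t) := by field_simp
  have h7 : x ^ (-t) * (t * (y / x - 1)) = t * x ^ (-(1 + t)) * (y - x) := by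
    rw [h3]; field_simp
  linarith

theorem hasSum_rpow_neg_sub {t : ℝ} (ht : 0 < t) :
    HasSum (fun n : ℕ => ((n : ℝ) + 1) ^ (-t) - ((n : ℝ) + 1 + 1) ^ (-t)) 1 := by
  rw [hasSum_iff_tendsto_nat_of_nonneg]
  · have h1 : ∀ n : ℕ, ∑ i ∈ Finset.range n, (((i : ℝ) + 1) ^ (-t) - ((i : ℝ) + 1 + 1) ^ (-t)) =
        1 - ((n : ℝ) + 1) ^ (-t) := by
      intro n
      induction n with
      | zero => simp
      | succ n ih =>
        rw [Finset.sum_range_succ, ih]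
        push_cast
        ring
    simp_rw [h1]
    have h2 : Filter.Tendsto (fun n : ℕ => ((n : ℝ) + 1) ^ (-t)) Filter.atTop (nhds 0) :=
      (tendsto_rpow_neg_atTop ht).comp
        (Filter.tendsto_atTop_add_const_right _ _ tendsto_natCast_atTop_atTop)
    simpa using h2.const_sub 1
  · intro n
    have : ((n : ℝ) + 1 + 1) ^ (-t) ≤ ((n : ℝ) + 1) ^ (-t) :=
      Real.rpow_le_rpow_of_nonpos (by positivity) (by linarith) (by linarith)
    linarith

theorem zeta_bounds {t : ℝ} (ht : 0 < t) :
    1 ≤ t * ∑' n : ℕ, (n : ℝ) ^ (-(1 + t)) ∧ t * ∑' n : ℕ, (n : ℝ) ^ (-(1 + t)) ≤ 1 + t := by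
  have hs := summable_nat_rpow_neg (s := 1 + t) (by linarith)
  have hs1 := (summable_nat_add_iff 1).mpr hs
  have hs2 := (summable_nat_add_iff 1).mpr hs1
  have e0 : ∑' n : ℕ, (n : ℝ) ^ (-(1 + t)) = ∑' n : ℕ, ((n + 1 : ℕ) : ℝ) ^ (-(1 + t)) := by
    rw [hs.tsum_eq_zero_add, Nat.cast_zero, Real.zero_rpow (by linarith : -(1 + t) ≠ 0), zero_add]
  have e1 : ∑' n : ℕ, (n : ℝ) ^ (-(1 + t)) =
      1 + ∑' n : ℕ, ((n + 1 + 1 : ℕ) : ℝ) ^ (-(1 + t)) := by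
    rw [e0, hs1.tsum_eq_zero_add]
    simp
  have hT := hasSum_rpow_neg_sub ht
  constructor
  · rw [e0, ← tsum_mul_left]
    refine hasSum_le (fun n => ?_) hT (hs1.mul_left t).hasSum
    have := rpow_neg_tangent (x := (n : ℝ) + 1) (y := (n : ℝ) + 1 + 1) (by positivity)
      (by positivity) ht.le
    push_cast
    linarith
  · rw [e1, mul_add, mul_one, add_comm, ← tsum_mul_left]
    refine add_le_add_left ?_ t
    refine hasSum_le (fun n => ?_) (hs2.mul_left t).hasSum hT
    have := rpow_neg_tangent (x := (n : ℝ) + 1 + 1) (y := (n : ℝ) + 1) (by positivity)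
      (by positivity) ht.le
    push_cast
    linarith

/-! ### The logarithmic derivative of `A_t` and its limit -/

/-- The coefficients of `A' / A`, where `A(z) = t ^ z ∏_{p > 2} (1 - z p ^ (-1 - t))⁻¹`. -/
noncomputable def logDerivCoeff (t : ℝ) (r : ℕ) : ℝ :=
  ∑' p : OddPrime, (((p : ℕ) : ℝ) ^ (-(1 + t))) ^ (r + 1) + if r = 0 then Real.log t else 0

/-- The limit of `logDerivCoeff t` as `t → 0+`. -/
noncomputable def logDerivCoeffLim (r : ℕ) : ℝ :=
  if r = 0 then -Real.log 2 - ∑' p : OddPrime, logTail ((p : ℕ) : ℝ)⁻¹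
  else ∑' p : OddPrime, (((p : ℕ) : ℝ)⁻¹) ^ (r + 1)

theorem summable_inv_sq_oddPrime : Summable fun p : OddPrime => (((p : ℕ) : ℝ)⁻¹) ^ 2 :=
  summable_oddPrime (f := fun n => ((n : ℝ)⁻¹) ^ 2)
    ((Real.summable_nat_pow_inv.mpr one_lt_two).congr fun n => by rw [inv_pow])

theorem summable_logTail_oddPrime {z : ℝ} (hz2 : z ≤ 2) :
    Summable fun p : OddPrime => logTail (z * ((p : ℕ) : ℝ)⁻¹) := by
  have hle : ∀ p : OddPrime, z * ((p : ℕ) : ℝ)⁻¹ ≤ 2 / 3 := fun p => by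
    have := p.three_le
    rw [← div_eq_mul_inv, div_le_div_iff₀ (by linarith) (by norm_num)]
    linarith
  refine (summable_inv_sq_oddPrime.mul_left (3 * z ^ 2)).of_nonneg_of_le
    (fun p => logTail_nonneg (by linarith [hle p])) fun p => ?_
  refine (logTail_le (hle p)).trans (le_of_eq (by ring))

theorem summable_log_mul_inv_sq_oddPrime :
    Summable fun p : OddPrime => Real.log (p : ℕ) * (((p : ℕ) : ℝ)⁻¹) ^ 2 := by
  refine summable_oddPrime (f := fun n => Real.log n * ((n : ℝ)⁻¹) ^ 2) ?_
  refine ((summable_nat_rpow_neg (s := 3 / 2) (by norm_num)).mul_left 2).of_nonneg_of_le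
    (fun n => mul_nonneg (Real.log_natCast_nonneg n) (by positivity)) fun n => ?_
  rcases Nat.eq_zero_or_pos n with rfl | hn
  · simp
  have hn' : (0 : ℝ) < n := by exact_mod_cast hn
  have h1 := Real.log_le_rpow_div (x := (n : ℝ)) hn'.le (ε := 1 / 2) (by norm_num)
  have h2 : (n : ℝ) ^ (-(3 / 2 : ℝ)) = (n : ℝ) ^ (1 / 2 : ℝ) * ((n : ℝ)⁻¹) ^ 2 := by
    rw [inv_pow, ← Real.rpow_natCast, ← Real.rpow_neg hn'.le, ← Real.rpow_add hn']
    norm_num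
  rw [h2, ← mul_assoc]
  refine mul_le_mul_of_nonneg_right ?_ (by positivity)
  linarith

theorem OddPrime.rpow_bounds (p : OddPrime) {t : ℝ} (ht : 0 ≤ t) :
    ((p : ℕ) : ℝ) ^ (-(1 + t)) ≤ ((p : ℕ) : ℝ)⁻¹ ∧
    ((p : ℕ) : ℝ)⁻¹ - ((p : ℕ) : ℝ) ^ (-(1 + t)) ≤ t * Real.log (p : ℕ) * ((p : ℕ) : ℝ)⁻¹ := by
  have hp := p.three_le
  have hp0 : (0 : ℝ) < (p : ℕ) := by linarith
  have h3 : ((p : ℕ) : ℝ) ^ (-(1 + t)) = ((p : ℕ) : ℝ)⁻¹ * ((p : ℕ) : ℝ) ^ (-t) := by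
    rw [neg_add, Real.rpow_add hp0, Real.rpow_neg_one]
  have h4 : ((p : ℕ) : ℝ) ^ (-t) ≤ 1 :=
    Real.rpow_le_one_of_one_le_of_nonpos (by linarith) (by linarith)
  have h5 := one_sub_rpow_neg_le (t := t) hp0
  have h6 : 0 < ((p : ℕ) : ℝ)⁻¹ := by positivity
  rw [h3]
  constructor
  · nlinarith
  · nlinarith

/-- Only the coefficient `r = 0` is singular, and the `log t` in it combines with `log ζ(1 + t)`. As
`t → 0`, the first logarithm tends to `0` and the second to `-log 2`, whence the value chosen for
`logDerivCoeffLim 0`. -/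
theorem logDerivCoeff_zero_eq {t : ℝ} (ht : 0 < t) :
    logDerivCoeff t 0 = Real.log (t * ∑' n : ℕ, (n : ℝ) ^ (-(1 + t))) +
      Real.log (1 - 2 ^ (-(1 + t))) - ∑' p : OddPrime, logTail (((p : ℕ) : ℝ) ^ (-(1 + t))) := by
  have hs : 1 < 1 + t := by linarith
  have hz := zeta_bounds ht
  have hz0 : (∑' n : ℕ, (n : ℝ) ^ (-(1 + t))) ≠ 0 := by
    intro h
    rw [h] at hz
    linarith [hz.1]
  have h1 := log_zeta_eq hs
  rw [tsum_primes_eq_add_tsum_oddPrime (fun p => -Real.log (1 - (p : ℝ) ^ (-(1 + t))))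
    (summable_log_primes hs)] at h1
  have hx : Summable fun p : OddPrime => ((p : ℕ) : ℝ) ^ (-(1 + t)) :=
    summable_oddPrime (summable_nat_rpow_neg hs)
  have hl : Summable fun p : OddPrime => -Real.log (1 - ((p : ℕ) : ℝ) ^ (-(1 + t))) :=
    (summable_log_primes hs).comp_injective
      (i := fun p : OddPrime => (⟨p, p.2.1⟩ : Nat.Primes)) fun p q h => by
        simpa [Subtype.ext_iff] using h
  have h2 : ∑' p : OddPrime, logTail (((p : ℕ) : ℝ) ^ (-(1 + t))) =
      ∑' p : OddPrime, -Real.log (1 - ((p : ℕ) : ℝ) ^ (-(1 + t))) -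
        ∑' p : OddPrime, ((p : ℕ) : ℝ) ^ (-(1 + t)) := by
    rw [← hl.tsum_sub hx]
    rfl
  rw [Real.log_mul ht.ne' hz0, h2, logDerivCoeff, ← h1]
  simp
  ring

/-- The decay `3 ^ (-r)` reflects that the least odd prime is `3`. The rate `t` comes from `1 - p ^
(-t) ≤ t log p` and the convergence of `∑ log p / p ^ 2`; the factor `r + 1` comes from
differentiating a power. -/
theorem exists_logDerivCoeff_bound : ∃ K : ℝ, 0 ≤ K ∧
    (∀ r : ℕ, |logDerivCoeffLim r| ≤ K * (((r : ℝ) + 1) * (1 / 3) ^ r)) ∧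
    ∀ t : ℝ, 0 < t → ∀ r : ℕ, |logDerivCoeff t r - logDerivCoeffLim r| ≤
      K * (((r : ℝ) + 1) * (1 / 3) ^ r) * t := by
  set S := ∑' p : OddPrime, Real.log (p : ℕ) * (((p : ℕ) : ℝ)⁻¹) ^ 2 with hS
  set S' := ∑' p : OddPrime, (((p : ℕ) : ℝ)⁻¹) ^ 2 with hS'
  have hlog : ∀ p : OddPrime, 0 ≤ Real.log (p : ℕ) := fun p => Real.log_natCast_nonneg _
  have hS0 : 0 ≤ S := tsum_nonneg fun p => mul_nonneg (hlog p) (by positivity)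
  have hS'0 : 0 ≤ S' := tsum_nonneg fun p => by positivity
  have hpow : ∀ (p : OddPrime) (r : ℕ), r ≠ 0 →
      (((p : ℕ) : ℝ)⁻¹) ^ (r + 1) ≤ 3 * (1 / 3) ^ r * (((p : ℕ) : ℝ)⁻¹) ^ 2 := by
    intro p r hr
    obtain ⟨m, rfl⟩ := Nat.exists_eq_succ_of_ne_zero hr
    have h1 : (((p : ℕ) : ℝ)⁻¹) ^ m ≤ (1 / 3) ^ m := by
      refine pow_le_pow_left₀ (by positivity) ?_ m
      rw [one_div]
      exact inv_anti₀ (by norm_num) p.three_le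
    calc (((p : ℕ) : ℝ)⁻¹) ^ (m.succ + 1) = (((p : ℕ) : ℝ)⁻¹) ^ m * (((p : ℕ) : ℝ)⁻¹) ^ 2 := by
          rw [← pow_add]
      _ ≤ (1 / 3) ^ m * (((p : ℕ) : ℝ)⁻¹) ^ 2 := by gcongr
      _ = _ := by rw [pow_succ (1 / 3 : ℝ)]; ring
  have hsum : ∀ r : ℕ, r ≠ 0 → Summable fun p : OddPrime => (((p : ℕ) : ℝ)⁻¹) ^ (r + 1) :=
    fun r hr => (summable_inv_sq_oddPrime.mul_left _).of_nonneg_of_le (fun p => by positivity)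
      fun p => hpow p r hr
  obtain ⟨A₀, hA₀⟩ : ∃ x, x = |logDerivCoeffLim 0| := ⟨_, rfl⟩
  have hA₀0 : 0 ≤ A₀ := hA₀ ▸ abs_nonneg _
  -- The summand `2` pays for the two logarithms in `logDerivCoeff_zero_eq`, each within `t` of its
  -- limit; `3 * S` for the sums over primes in the differences; `3 * S'` and `A₀` for the limits
  -- with `r ≠ 0` and `r = 0`.
  refine ⟨2 + 3 * S + 3 * S' + A₀, by positivity, fun r => ?_, fun t ht r => ?_⟩
  · rcases eq_or_ne r 0 with rfl | hr
    · rw [← hA₀]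
      simp
      positivity
    · have h1 : |logDerivCoeffLim r| ≤ 3 * (1 / 3) ^ r * S' := by
        rw [logDerivCoeffLim, if_neg hr, abs_of_nonneg (tsum_nonneg fun p => by positivity), hS',
          ← tsum_mul_left]
        exact (hsum r hr).tsum_le_tsum (fun p => hpow p r hr)
          (summable_inv_sq_oddPrime.mul_left _)
      refine h1.trans ?_
      have h2 : (0 : ℝ) < (1 / 3) ^ r := by positivity
      have h3 : (1 : ℝ) ≤ (r : ℝ) + 1 := by linarith [Nat.cast_nonneg (α := ℝ) r]
      have h4 : 3 * S' ≤ 2 + 3 * S + 3 * S' + A₀ := by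
        linarith [hA₀0]
      calc 3 * (1 / 3) ^ r * S' = (3 * S') * (1 * (1 / 3) ^ r) := by ring
        _ ≤ _ := by gcongr
  · rcases eq_or_ne r 0 with rfl | hr
    · rw [logDerivCoeff_zero_eq ht, logDerivCoeffLim, if_pos rfl]
      have hz := zeta_bounds ht
      set Z := t * ∑' n : ℕ, (n : ℝ) ^ (-(1 + t))
      have hZ0 : 0 ≤ Real.log Z := Real.log_nonneg hz.1
      have hZ1 : Real.log Z ≤ t := by
        linarith [Real.log_le_sub_one_of_pos (by linarith : 0 < Z)]
      have h2t : (2 : ℝ) ^ (-(1 + t)) = 2⁻¹ * 2 ^ (-t) := by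
        rw [neg_add, Real.rpow_add two_pos, Real.rpow_neg_one]
      have h2t1 : (2 : ℝ) ^ (-t) ≤ 1 :=
        Real.rpow_le_one_of_one_le_of_nonpos (by norm_num) (by linarith)
      have h2t2 := one_sub_rpow_neg_le (t := t) two_pos
      have hl2 : Real.log (1 - 2 ^ (-(1 + t))) = Real.log (2 - 2 ^ (-t)) - Real.log 2 := by
        rw [← Real.log_div (by linarith) two_ne_zero, h2t]
        congr 1
        ring
      have hl20 : 0 ≤ Real.log (2 - 2 ^ (-t)) := Real.log_nonneg (by linarith)
      have hl21 : Real.log (2 - 2 ^ (-t)) ≤ t := by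
        have h := Real.log_le_sub_one_of_pos (by linarith : 0 < 2 - (2 : ℝ) ^ (-t))
        have : t * Real.log 2 ≤ t * 1 :=
          mul_le_mul_of_nonneg_left (by linarith [Real.log_two_lt_d9]) ht.le
        linarith
      have hterm : ∀ p : OddPrime,
          |logTail (((p : ℕ) : ℝ) ^ (-(1 + t))) - logTail ((p : ℕ) : ℝ)⁻¹| ≤
            2 * t * (Real.log (p : ℕ) * (((p : ℕ) : ℝ)⁻¹) ^ 2) := by
        intro p
        have hb := p.rpow_bounds ht.le
        have hp := p.three_le
        have hi : ((p : ℕ) : ℝ)⁻¹ ≤ 1 / 2 := by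
          rw [one_div]
          exact inv_anti₀ (by norm_num) (by linarith)
        refine (abs_logTail_sub_le hb.1 (by positivity) hi (by positivity)).trans ?_
        calc _ ≤ 2 * ((p : ℕ) : ℝ)⁻¹ * (t * Real.log (p : ℕ) * ((p : ℕ) : ℝ)⁻¹) := by
              refine mul_le_mul_of_nonneg_left hb.2 (by positivity)
          _ = _ := by ring
      have hs0 : Summable fun p : OddPrime => logTail ((p : ℕ) : ℝ)⁻¹ := by
        simpa using summable_logTail_oddPrime (z := 1) (by norm_num)
      have hsd : Summable fun p : OddPrime =>
          logTail (((p : ℕ) : ℝ) ^ (-(1 + t))) - logTail ((p : ℕ) : ℝ)⁻¹ :=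
        Summable.of_norm_bounded (summable_log_mul_inv_sq_oddPrime.mul_left (2 * t)) hterm
      have hst : Summable fun p : OddPrime => logTail (((p : ℕ) : ℝ) ^ (-(1 + t))) :=
        (hsd.add hs0).congr fun p => by ring
      have hdiff : |∑' p : OddPrime, logTail (((p : ℕ) : ℝ) ^ (-(1 + t))) -
          ∑' p : OddPrime, logTail ((p : ℕ) : ℝ)⁻¹| ≤ 2 * t * S := by
        rw [← hst.tsum_sub hs0, hS, ← tsum_mul_left]
        rw [← Real.norm_eq_abs]
        exact tsum_of_norm_bounded
          (summable_log_mul_inv_sq_oddPrime.mul_left (2 * t)).hasSum hterm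
      rw [hl2]
      have hd := abs_le.mp hdiff
      have hn := mul_nonneg (hA₀0) ht.le
      have hS't := mul_nonneg hS'0 ht.le
      have hSt := mul_nonneg hS0 ht.le
      rw [abs_le]
      constructor
      · simp only [Nat.cast_zero, pow_zero]
        nlinarith
      · simp only [Nat.cast_zero, pow_zero]
        nlinarith
    · rw [logDerivCoeff, logDerivCoeffLim, if_neg hr, if_neg hr, add_zero]
      have hst : Summable fun p : OddPrime => (((p : ℕ) : ℝ) ^ (-(1 + t))) ^ (r + 1) :=
        (hsum r hr).of_nonneg_of_le (fun p => by positivity) fun p =>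
          pow_le_pow_left₀ (by positivity) (p.rpow_bounds ht.le).1 _
      have hterm : ∀ p : OddPrime,
          ‖(((p : ℕ) : ℝ) ^ (-(1 + t))) ^ (r + 1) - (((p : ℕ) : ℝ)⁻¹) ^ (r + 1)‖ ≤
            3 * (((r : ℝ) + 1) * (1 / 3) ^ r) * t *
              (Real.log (p : ℕ) * (((p : ℕ) : ℝ)⁻¹) ^ 2) := by
        intro p
        have hb := p.rpow_bounds ht.le
        set x := ((p : ℕ) : ℝ)⁻¹ with hx
        set y := ((p : ℕ) : ℝ) ^ (-(1 + t))
        have hx0 : 0 ≤ x := by positivity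
        have hy0 : 0 ≤ y := by positivity
        have hmono : y ^ (r + 1) ≤ x ^ (r + 1) := pow_le_pow_left₀ hy0 hb.1 _
        have h1 : x ^ (r + 1) - y ^ (r + 1) ≤ ((r : ℝ) + 1) * x ^ r * (x - y) := by
          have := abs_pow_sub_pow_le x y (r + 1)
          rw [abs_of_nonneg (sub_nonneg.mpr hmono), abs_of_nonneg (sub_nonneg.mpr hb.1),
            abs_of_nonneg hx0, abs_of_nonneg hy0, max_eq_left hb.1] at this
          push_cast at this
          linarith
        rw [Real.norm_eq_abs, abs_sub_comm, abs_of_nonneg (sub_nonneg.mpr hmono)]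
        calc _ ≤ ((r : ℝ) + 1) * x ^ r * (x - y) := h1
          _ ≤ ((r : ℝ) + 1) * x ^ r * (t * Real.log (p : ℕ) * x) := by
              refine mul_le_mul_of_nonneg_left hb.2 (by positivity)
          _ = ((r : ℝ) + 1) * (t * Real.log (p : ℕ)) * x ^ (r + 1) := by ring
          _ ≤ ((r : ℝ) + 1) * (t * Real.log (p : ℕ)) * (3 * (1 / 3) ^ r * x ^ 2) := by
              refine mul_le_mul_of_nonneg_left (hpow p r hr) ?_
              exact mul_nonneg (by positivity) (mul_nonneg ht.le (hlog p))
          _ = _ := by ring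
      have h2 : |∑' p : OddPrime, (((p : ℕ) : ℝ) ^ (-(1 + t))) ^ (r + 1) -
          ∑' p : OddPrime, (((p : ℕ) : ℝ)⁻¹) ^ (r + 1)| ≤
          3 * (((r : ℝ) + 1) * (1 / 3) ^ r) * t * S := by
        rw [← hst.tsum_sub (hsum r hr), hS, ← tsum_mul_left, ← Real.norm_eq_abs]
        exact tsum_of_norm_bounded (summable_log_mul_inv_sq_oddPrime.mul_left _).hasSum hterm
      refine h2.trans ?_
      have h4 : 3 * S ≤ 2 + 3 * S + 3 * S' + A₀ := by
        linarith [hA₀0]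
      calc 3 * (((r : ℝ) + 1) * (1 / 3) ^ r) * t * S
          = (3 * S) * (((r : ℝ) + 1) * (1 / 3) ^ r) * t := by ring
        _ ≤ _ := by gcongr

/-! ### The Euler factors of `d` and the logarithm of `A` -/

theorem oddEulerFactor_pos (p : OddPrime) : 0 < oddEulerFactor p := by
  have hp := p.three_le
  have h1 : 0 < 1 - 2 / ((p : ℕ) : ℝ) := by
    rw [sub_pos, div_lt_one (by linarith)]
    linarith
  have h2 : 0 < 1 - 1 / ((p : ℕ) : ℝ) := by
    rw [sub_pos, div_lt_one (by linarith)]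
    linarith
  unfold oddEulerFactor
  positivity

theorem log_oddEulerFactor (p : OddPrime) : Real.log (oddEulerFactor p) =
    logTail (2 * ((p : ℕ) : ℝ)⁻¹) - 2 * logTail ((p : ℕ) : ℝ)⁻¹ := by
  have hp := p.three_le
  have h1 : 0 < 1 - 2 / ((p : ℕ) : ℝ) := by
    rw [sub_pos, div_lt_one (by linarith)]
    linarith
  have h2 : 0 < 1 - 1 / ((p : ℕ) : ℝ) := by
    rw [sub_pos, div_lt_one (by linarith)]
    linarith
  rw [oddEulerFactor, Real.log_mul (inv_pos.mpr h1).ne' (pow_pos h2 2).ne', Real.log_inv,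
    Real.log_pow, logTail, logTail, div_eq_mul_inv, one_div]
  push_cast
  ring

theorem summable_log_oddEulerFactor : Summable fun p => Real.log (oddEulerFactor p) := by
  have h1 : Summable fun p : OddPrime => logTail ((p : ℕ) : ℝ)⁻¹ := by
    simpa using summable_logTail_oddPrime (z := 1) (by norm_num)
  exact ((summable_logTail_oddPrime le_rfl).sub (h1.mul_left 2)).congr fun p =>
    (log_oddEulerFactor p).symm

theorem hasSum_logTail {x : ℝ} (hx : |x| < 1) :
    HasSum (fun r : ℕ => x ^ (r + 1 + 1) / (((r + 1 : ℕ) : ℝ) + 1)) (logTail x) := by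
  rw [hasSum_nat_add_iff (f := fun r : ℕ => x ^ (r + 1) / ((r : ℝ) + 1)) 1]
  simpa [logTail] using Real.hasSum_pow_div_log_of_abs_lt_one hx

/-- The linear terms `z / p`, whose sum diverges, have been renormalized into `logDerivCoeffLim 0`.
The terms of order at least two form a nonnegative double series, which may be summed over `r`
first. -/
theorem tsum_logDerivCoeffLim {z : ℝ} (hz0 : 0 ≤ z) (hz2 : z ≤ 2)
    (hs : Summable fun r : ℕ => logDerivCoeffLim r / ((r : ℝ) + 1) * z ^ (r + 1)) :
    ∑' r : ℕ, logDerivCoeffLim r / ((r : ℝ) + 1) * z ^ (r + 1) =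
      logDerivCoeffLim 0 * z + ∑' p : OddPrime, logTail (z * ((p : ℕ) : ℝ)⁻¹) := by
  have hx : ∀ p : OddPrime, |z * ((p : ℕ) : ℝ)⁻¹| < 1 := fun p => by
    have := p.three_le
    rw [abs_of_nonneg (by positivity), ← div_eq_mul_inv, div_lt_one (by linarith)]
    linarith
  set F : OddPrime × ℕ → ℝ := fun q =>
    (z * ((q.1 : ℕ) : ℝ)⁻¹) ^ (q.2 + 1 + 1) / (((q.2 + 1 : ℕ) : ℝ) + 1) with hF
  have hFs : Summable F := by
    rw [summable_prod_of_nonneg (fun q => by positivity)]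
    refine ⟨fun p => (hasSum_logTail (hx p)).summable, ?_⟩
    exact (summable_logTail_oddPrime hz2).congr fun p => (hasSum_logTail (hx p)).tsum_eq.symm
  rw [hs.tsum_eq_zero_add]
  congr 1
  · simp
  · calc ∑' r : ℕ, logDerivCoeffLim (r + 1) / (((r + 1 : ℕ) : ℝ) + 1) * z ^ (r + 1 + 1)
        = ∑' r : ℕ, ∑' p : OddPrime, F (p, r) := by
          refine tsum_congr fun r => ?_
          rw [logDerivCoeffLim, if_neg (Nat.succ_ne_zero r), div_mul_eq_mul_div, ← tsum_mul_right,
            ← tsum_div_const]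
          refine tsum_congr fun p => ?_
          simp only [hF]
          rw [mul_pow, mul_comm (z ^ _)]
      _ = ∑' p : OddPrime, ∑' r : ℕ, F (p, r) := Summable.tsum_comm hFs
      _ = _ := tsum_congr fun p => (hasSum_logTail (hx p)).tsum_eq

/-! ### Factorization of the generating function -/

/-- The coefficients of `(1 - 2 ^ (-1 - t) z)⁻¹ t ^ (-z)` as a power series in `z`. -/
noncomputable def singularCoeff (n : ℕ) (t : ℝ) : ℝ :=
  ∑ q ∈ Finset.HasAntidiagonal.antidiagonal n,
    ((2 : ℝ) ^ (-(1 + t))) ^ q.1 * ((-Real.log t) ^ q.2 / (q.2.factorial : ℝ))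

theorem derivative_mk_pow_div_factorial (a : ℝ) :
    PowerSeries.derivative ℝ (PowerSeries.mk fun n => a ^ n / (n.factorial : ℝ)) =
      PowerSeries.C a * PowerSeries.mk fun n => a ^ n / (n.factorial : ℝ) := by
  ext n
  rw [PowerSeries.coeff_derivative, PowerSeries.coeff_C_mul, PowerSeries.coeff_mk,
    PowerSeries.coeff_mk, Nat.factorial_succ, pow_succ]
  push_cast
  field_simp

theorem mk_pow_div_factorial_mul_neg (a : ℝ) :
    (PowerSeries.mk fun n => a ^ n / (n.factorial : ℝ)) *
      (PowerSeries.mk fun n => (-a) ^ n / (n.factorial : ℝ)) = 1 := by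
  have h : ∀ b : ℝ, (PowerSeries.mk fun n => b ^ n / (n.factorial : ℝ)) =
      PowerSeries.rescale b (PowerSeries.exp ℝ) := by
    intro b
    ext n
    simp [PowerSeries.coeff_rescale, PowerSeries.coeff_exp, div_eq_mul_inv]
  rw [h, h, PowerSeries.exp_mul_exp_eq_exp_add]
  simp

theorem mk_pow_mul_one_sub (x : ℝ) :
    (PowerSeries.mk fun n => x ^ n) * (1 - PowerSeries.C x * PowerSeries.X) = 1 := by
  ext n
  rcases n with _ | n
  · simp
  · rw [mul_sub, mul_one, map_sub, mul_left_comm, PowerSeries.coeff_C_mul,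
      PowerSeries.coeff_succ_mul_X, PowerSeries.coeff_mk, PowerSeries.coeff_mk, pow_succ]
    simp
    ring

theorem mk_logDerivCoeff {t : ℝ} (ht : 0 < t) :
    PowerSeries.mk (fun r => primePowerSum (r + 1) (1 + t)) =
      PowerSeries.mk (logDerivCoeff t) +
        PowerSeries.C ((2 : ℝ) ^ (-(1 + t))) *
          (PowerSeries.mk fun n => ((2 : ℝ) ^ (-(1 + t))) ^ n) -
        PowerSeries.C (Real.log t) := by
  ext r
  rw [map_sub, map_add, PowerSeries.coeff_C_mul, PowerSeries.coeff_mk, PowerSeries.coeff_mk,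
    PowerSeries.coeff_mk, PowerSeries.coeff_C, primePowerSum, logDerivCoeff,
    tsum_primes_eq_add_tsum_oddPrime (fun p => ((p : ℝ) ^ (-(1 + t))) ^ (r + 1))
      (summable_primePower r (by linarith))]
  push_cast
  ring

/-- Here `A = P Y E` is the formal generating function `P` divided by its singular factors `G = Y⁻¹`
and `E' = E⁻¹`. Its logarithmic derivative is the sum of those of `P`, `Y` and `E`, in which the
prime `2` cancels. -/
theorem exists_isLogDerivSolution {t : ℝ} (ht : 0 < t) :
    ∃ a : ℕ → ℝ, IsLogDerivSolution (logDerivCoeff t) a ∧ ∀ k,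
      almostPrimeZeta k (1 + t) =
        ∑ q ∈ Finset.HasAntidiagonal.antidiagonal k, a q.1 * singularCoeff q.2 t := by
  have hs : 1 < 1 + t := by linarith
  set x := (2 : ℝ) ^ (-(1 + t)) with hx
  set P : PowerSeries ℝ := PowerSeries.mk fun k => almostPrimeZeta k (1 + t) with hP
  set E : PowerSeries ℝ := PowerSeries.mk fun n => (Real.log t) ^ n / (n.factorial : ℝ) with hE
  set E' : PowerSeries ℝ := PowerSeries.mk fun n => (-Real.log t) ^ n / (n.factorial : ℝ) with hE'
  set G : PowerSeries ℝ := PowerSeries.mk fun n => x ^ n with hG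
  set Y : PowerSeries ℝ := 1 - PowerSeries.C x * PowerSeries.X with hY
  set A : PowerSeries ℝ := P * Y * E with hA
  have hGY : G * Y = 1 := mk_pow_mul_one_sub x
  have hEE : E * E' = 1 := mk_pow_div_factorial_mul_neg _
  have hdP : PowerSeries.derivative ℝ P =
      (PowerSeries.mk fun r => primePowerSum (r + 1) (1 + t)) * P := by
    ext n
    rw [PowerSeries.coeff_derivative, PowerSeries.coeff_mul, hP, PowerSeries.coeff_mk, mul_comm,
      almostPrimeZeta_succ n hs]
    simp
  have hdE : PowerSeries.derivative ℝ E = PowerSeries.C (Real.log t) * E :=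
    derivative_mk_pow_div_factorial _
  have hdY : PowerSeries.derivative ℝ Y = -PowerSeries.C x := by
    rw [hY, map_sub, Derivation.leibniz]
    simp
  have hdA : PowerSeries.derivative ℝ A = PowerSeries.mk (logDerivCoeff t) * A := by
    rw [hA, Derivation.leibniz, Derivation.leibniz, hdP, hdE, hdY, mk_logDerivCoeff ht]
    simp only [smul_eq_mul]
    -- The prime `2` contributes `x G` through `P` and `-x / Y` through `Y`; these cancel because `G
    -- Y = 1`.
    linear_combination (PowerSeries.C x * P * E) * hGY
  have hPA : P = A * (G * E') := by
    calc P = P * (G * Y) * (E * E') := by rw [hGY, hEE]; ring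
      _ = A * (G * E') := by rw [hA]; ring
  have hA0 : PowerSeries.coeff 0 A = 1 := by
    simp [hA, hP, hY, hE, almostPrimeZeta_zero hs]
  clear_value A
  refine ⟨fun n => PowerSeries.coeff n A, ⟨hA0, fun n => ?_⟩, fun k => ?_⟩
  · have := congrArg (PowerSeries.coeff n) hdA
    rw [PowerSeries.coeff_derivative, PowerSeries.coeff_mul] at this
    rw [mul_comm, this]
    simp
  · have := congrArg (PowerSeries.coeff k) hPA
    rw [PowerSeries.coeff_mul, hP, PowerSeries.coeff_mk] at this
    rw [this]
    refine Finset.sum_congr rfl fun q _ => ?_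
    rw [PowerSeries.coeff_mul, singularCoeff]
    simp only [hG, hE', hx, PowerSeries.coeff_mk]

/-! ### The limit series `A` -/

theorem summable_succ_mul_geometric {r : ℝ} (h0 : 0 ≤ r) (h1 : r < 1) :
    Summable fun n : ℕ => ((n : ℝ) + 1) * r ^ n := by
  have hr : ‖r‖ < 1 := by rwa [Real.norm_of_nonneg h0]
  refine ((summable_pow_mul_geometric_of_norm_lt_one 1 hr).add
    (summable_geometric_of_lt_one h0 h1)).congr fun n => ?_
  ring

/-- The weight `R = 5 / 2` lies strictly between `2`, where `A` is evaluated, and `3`, where the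
factor at `p = 3` has its pole. At `z = 1` the sums of `logTail` cancel and leave `exp(-log 2)`; at
`z = 2` they combine into the logarithms of the Euler factors of `d`. -/
theorem exists_limit_coeff : ∃ (a : ℕ → ℝ) (M : ℝ), 0 ≤ M ∧
    (∀ j, |a j| ≤ M * (2 / 5) ^ j) ∧
    (∀ t, 0 < t → t ≤ 1 → ∀ a', IsLogDerivSolution (logDerivCoeff t) a' →
      ∀ j, |a' j - a j| ≤ M * (2 / 5) ^ j * t) ∧
    ∑' j, a j = 1 / 2 ∧ ∑' j, a j * 2 ^ j = dConst := by
  obtain ⟨K, hK0, hK, hKt⟩ := exists_logDerivCoeff_bound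
  set a := logDerivSolution logDerivCoeffLim with ha_def
  have ha : IsLogDerivSolution logDerivCoeffLim a := isLogDerivSolution_logDerivSolution _
  set T := ∑' n : ℕ, ((n : ℝ) + 1) * (5 / 6 : ℝ) ^ n
  have hT0 : 0 ≤ T := tsum_nonneg fun n => by positivity
  have hconv : ∀ {f : ℕ → ℝ} {B : ℝ}, 0 ≤ B →
      (∀ r : ℕ, |f r| ≤ B * (((r : ℝ) + 1) * (1 / 3) ^ r)) →
      ∀ n, ∑ r ∈ Finset.range n, |f r| * (5 / 2) ^ r ≤ B * T := by
    intro f B hB hf n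
    have hs := summable_succ_mul_geometric (r := 5 / 6) (by norm_num) (by norm_num)
    calc ∑ r ∈ Finset.range n, |f r| * (5 / 2) ^ r
        ≤ ∑ r ∈ Finset.range n, B * (((r : ℝ) + 1) * (5 / 6) ^ r) := by
          refine Finset.sum_le_sum fun r _ => ?_
          calc |f r| * (5 / 2) ^ r ≤ B * (((r : ℝ) + 1) * (1 / 3) ^ r) * (5 / 2) ^ r :=
                mul_le_mul_of_nonneg_right (hf r) (by positivity)
            _ = B * (((r : ℝ) + 1) * ((1 / 3) * (5 / 2)) ^ r) := by rw [mul_pow]; ring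
            _ = _ := by norm_num
      _ = B * ∑ r ∈ Finset.range n, (((r : ℝ) + 1) * (5 / 6) ^ r) := by rw [Finset.mul_sum]
      _ ≤ B * T := mul_le_mul_of_nonneg_left
          (hs.sum_le_tsum _ fun n _ => by positivity) hB
  have hR : (0 : ℝ) < 5 / 2 := by norm_num
  set M₁ := (1 + 5 / 2 * (K * T)) ^ ⌈1 + 5 / 2 * (K * T)⌉₊
  have hM₁0 : 0 ≤ M₁ := by positivity
  have hM₁ : ∀ n, |a n| * (5 / 2) ^ n ≤ M₁ := ha.abs_mul_pow_le hR (hconv hK0 hK)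
  set B₂ := (1 + 5 / 2 * ((2 * K) * T)) ^ ⌈1 + 5 / 2 * ((2 * K) * T)⌉₊
  have hB₂0 : 0 ≤ B₂ := by positivity
  set M₂ := 5 / 2 * (K * T) * M₁ * B₂
  have hM₂0 : 0 ≤ M₂ := by positivity
  have hdiv : ∀ {x y : ℝ} {n : ℕ}, x * (5 / 2) ^ n ≤ y → x ≤ y * (2 / 5) ^ n := by
    intro x y n h
    have := mul_le_mul_of_nonneg_right h (by positivity : (0 : ℝ) ≤ (2 / 5) ^ n)
    rwa [mul_assoc, ← mul_pow, show (5 / 2 : ℝ) * (2 / 5) = 1 by norm_num, one_pow,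
      mul_one] at this
  have habs : ∀ j, |a j| ≤ (M₁ + M₂) * (2 / 5) ^ j := fun j =>
    (hdiv (hM₁ j)).trans (mul_le_mul_of_nonneg_right (by linarith) (by positivity))
  refine ⟨a, M₁ + M₂, by positivity, habs, ?_, ?_⟩
  · intro t ht0 ht1 a' ha' j
    have hd : ∀ n, ∑ r ∈ Finset.range n, |logDerivCoeff t r - logDerivCoeffLim r| * (5 / 2) ^ r ≤
        (K * t) * T := hconv (by positivity) fun r => (hKt t ht0 r).trans (le_of_eq (by ring))
    have hc' : ∀ n, ∑ r ∈ Finset.range n, |logDerivCoeff t r| * (5 / 2) ^ r ≤ (2 * K) * T := by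
      refine hconv (by positivity) fun r => ?_
      have h1 := hK r
      have h2 := hKt t ht0 r
      have h3 : K * (((r : ℝ) + 1) * (1 / 3) ^ r) * t ≤ K * (((r : ℝ) + 1) * (1 / 3) ^ r) :=
        mul_le_of_le_one_right (by positivity) ht1
      have h4 := abs_add_le (logDerivCoeff t r - logDerivCoeffLim r) (logDerivCoeffLim r)
      rw [sub_add_cancel] at h4
      linarith
    have h := hdiv (ha.abs_sub_mul_pow_le ha' hR hM₁0 hc' hd hM₁ j)
    refine h.trans ?_
    have h2 : 5 / 2 * (K * t * T) * M₁ * B₂ * (2 / 5) ^ j = M₂ * (2 / 5) ^ j * t := by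
      simp only [M₂]
      ring
    refine (le_of_eq h2).trans ?_
    gcongr
    linarith
  -- The radius `9 / 4` is chosen between `2` and `5 / 2`, which leaves room to differentiate
  -- termwise at `z = 2`.
  · have hsa : Summable fun n : ℕ => ((n : ℝ) + 1) * |a (n + 1)| * (9 / 4) ^ n := by
      refine ((summable_succ_mul_geometric (r := 9 / 10) (by norm_num) (by norm_num)).mul_left
        ((M₁ + M₂) * (2 / 5))).of_nonneg_of_le (fun n => by positivity) fun n => ?_
      calc ((n : ℝ) + 1) * |a (n + 1)| * (9 / 4) ^ n
          ≤ ((n : ℝ) + 1) * ((M₁ + M₂) * (2 / 5) ^ (n + 1)) * (9 / 4) ^ n := by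
            gcongr
            exact habs _
        _ = (M₁ + M₂) * (2 / 5) * (((n : ℝ) + 1) * ((2 / 5) * (9 / 4)) ^ n) := by
            rw [mul_pow]; ring
        _ = _ := by norm_num
    have hsc : Summable fun n : ℕ => |logDerivCoeffLim n| * (9 / 4) ^ n := by
      refine ((summable_succ_mul_geometric (r := 3 / 4) (by norm_num) (by norm_num)).mul_left
        K).of_nonneg_of_le (fun n => by positivity) fun n => ?_
      calc |logDerivCoeffLim n| * (9 / 4) ^ n
          ≤ K * (((n : ℝ) + 1) * (1 / 3) ^ n) * (9 / 4) ^ n := by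
            gcongr
            exact hK _
        _ = K * (((n : ℝ) + 1) * ((1 / 3) * (9 / 4)) ^ n) := by
            rw [mul_pow]; ring
        _ = _ := by norm_num
    have hval : ∀ z : ℝ, 0 ≤ z → z ≤ 2 → ∑' n, a n * z ^ n = Real.exp (logDerivCoeffLim 0 * z +
        ∑' p : OddPrime, logTail (z * ((p : ℕ) : ℝ)⁻¹)) := by
      intro z hz0 hz2
      rw [ha.tsum_mul_pow_eq_exp (ρ := 9 / 4) (by norm_num) hsa hsc hz0 (by linarith),
        tsum_logDerivCoeffLim hz0 hz2]
      refine Summable.of_norm_bounded (hsc.mul_left (9 / 4)) fun n => ?_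
      rw [norm_mul, norm_div, norm_pow, Real.norm_eq_abs, Real.norm_of_nonneg hz0,
        Real.norm_of_nonneg (by positivity : (0 : ℝ) ≤ (n : ℝ) + 1)]
      calc |logDerivCoeffLim n| / ((n : ℝ) + 1) * z ^ (n + 1)
          ≤ |logDerivCoeffLim n| * (9 / 4) ^ (n + 1) := by
            gcongr
            · exact div_le_self (abs_nonneg _) (by linarith [Nat.cast_nonneg (α := ℝ) n])
            · linarith
        _ = _ := by ring
    have h0 : logDerivCoeffLim 0 = -Real.log 2 - ∑' p : OddPrime, logTail ((p : ℕ) : ℝ)⁻¹ := by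
      simp [logDerivCoeffLim]
    have hs1 : Summable fun p : OddPrime => logTail ((p : ℕ) : ℝ)⁻¹ := by
      simpa using summable_logTail_oddPrime (z := 1) (by norm_num)
    constructor
    · have h := hval 1 zero_le_one one_le_two
      simp only [one_pow, mul_one, one_mul] at h
      rw [h, h0, sub_add_cancel, Real.exp_neg, Real.exp_log two_pos, one_div]
    · rw [hval 2 zero_le_two le_rfl, h0, dConst,
        ← Real.rexp_tsum_eq_tprod oddEulerFactor_pos summable_log_oddEulerFactor,
        tsum_congr log_oddEulerFactor,
        (summable_logTail_oddPrime le_rfl).tsum_sub (hs1.mul_left 2), tsum_mul_left]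
      have h4 : (1 / 4 : ℝ) = Real.exp (-Real.log 2 * 2) := by
        rw [Real.exp_mul, Real.exp_neg, Real.exp_log two_pos]
        norm_num
      rw [h4, ← Real.exp_add]
      congr 1
      ring

/-! ### Integrals of powers of `t` and `log t` -/

theorem tendsto_mul_neg_log_pow (n : ℕ) :
    Filter.Tendsto (fun t : ℝ => t * (-Real.log t) ^ n) (nhdsWithin 0 (Set.Ioi 0)) (nhds 0) := by
  have h := (Real.isLittleO_pow_log_id_atTop (n := n)).tendsto_div_nhds_zero.comp
    tendsto_inv_nhdsGT_zero
  refine h.congr fun t => ?_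
  simp [Real.log_inv, div_eq_mul_inv, mul_comm]

/-- Integration by parts, by induction on `m`. The antiderivative is only required to be continuous
at `0`, where the logarithm is singular. -/
theorem exists_antideriv_pow_mul_log_pow (c m : ℕ) : ∃ G : ℝ → ℝ,
    ContinuousOn G (Set.Icc 0 1) ∧ G 0 = 0 ∧ G 1 = (((c : ℝ) + 1) ^ (m + 1))⁻¹ ∧
    ∀ t ∈ Set.Ioo (0 : ℝ) 1,
      HasDerivAt G (t ^ c * ((-Real.log t) ^ m / (m.factorial : ℝ))) t := by
  have hc : (c : ℝ) + 1 ≠ 0 := by positivity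
  induction m with
  | zero =>
    refine ⟨fun t => t ^ (c + 1) / ((c : ℝ) + 1), by fun_prop, by simp, by simp, fun t _ => ?_⟩
    refine ((hasDerivAt_pow (c + 1) t).div_const _).congr_deriv ?_
    push_cast
    simp
    field_simp
  | succ m ih =>
    obtain ⟨G, hG, hG0, hG1, hGd⟩ := ih
    refine ⟨fun t => t ^ c / ((c : ℝ) + 1) * (t * (-Real.log t) ^ (m + 1)) /
      ((m + 1).factorial : ℝ) + G t / ((c : ℝ) + 1), ?_, ?_, ?_, fun t ht => ?_⟩
    -- A factor `t` is kept next to the logarithm, so that the product tends to `0` at the origin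
    -- even when `c = 0`.
    · have h1 : ContinuousOn (fun t : ℝ => t * (-Real.log t) ^ (m + 1)) (Set.Icc 0 1) := by
        intro t ht
        rcases eq_or_lt_of_le ht.1 with rfl | h
        · refine ContinuousWithinAt.mono ?_ Set.Icc_subset_Ici_self
          rw [← continuousWithinAt_Ioi_iff_Ici, ContinuousWithinAt]
          simpa using tendsto_mul_neg_log_pow (m + 1)
        · have := Real.continuousAt_log h.ne'
          exact (by fun_prop : ContinuousAt (fun t : ℝ => t * (-Real.log t) ^ (m + 1)) t)
            |>.continuousWithinAt
      have h2 : ContinuousOn (fun t : ℝ => t ^ c / ((c : ℝ) + 1)) (Set.Icc 0 1) := by fun_prop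
      exact ((h2.mul h1).div_const _).add (hG.div_const _)
    · simp [hG0]
    · simp only [hG1, pow_succ _ (m + 1)]
      simp
      field_simp
    · have h1 : HasDerivAt (fun t : ℝ => t ^ (c + 1)) (((c : ℝ) + 1) * t ^ c) t := by
        simpa using hasDerivAt_pow (c + 1) t
      have h2 : HasDerivAt (fun t : ℝ => (-Real.log t) ^ (m + 1))
          (((m : ℝ) + 1) * (-Real.log t) ^ m * (-t⁻¹)) t := by
        simpa using ((Real.hasDerivAt_log ht.1.ne').fun_neg.fun_pow (m + 1))
      have h3 := ((h1.fun_mul h2).div_const (((c : ℝ) + 1) * ((m + 1).factorial : ℝ))).fun_add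
        ((hGd t ht).div_const ((c : ℝ) + 1))
      have ht0 := ht.1.ne'
      refine (h3.congr_deriv ?_).congr_of_eventuallyEq (Filter.Eventually.of_forall fun t => ?_)
      · rw [Nat.factorial_succ]
        push_cast
        have := (Nat.cast_ne_zero (R := ℝ)).mpr (Nat.factorial_ne_zero m)
        field_simp
        ring
      · dsimp only
        rw [pow_succ t c]
        field_simp

theorem integral_pow_mul_log_pow (c m : ℕ) :
    IntervalIntegrable (fun t : ℝ => t ^ c * ((-Real.log t) ^ m / (m.factorial : ℝ)))
      MeasureTheory.volume 0 1 ∧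
    ∫ t in (0 : ℝ)..1, t ^ c * ((-Real.log t) ^ m / (m.factorial : ℝ)) =
      (((c : ℝ) + 1) ^ (m + 1))⁻¹ := by
  obtain ⟨G, hG, hG0, hG1, hGd⟩ := exists_antideriv_pow_mul_log_pow c m
  have hint : IntervalIntegrable (fun t : ℝ => t ^ c * ((-Real.log t) ^ m / (m.factorial : ℝ)))
      MeasureTheory.volume 0 1 := by
    rw [intervalIntegrable_iff_integrableOn_Ioc_of_le zero_le_one]
    refine intervalIntegral.integrableOn_deriv_of_nonneg hG hGd fun t ht => ?_
    have : 0 ≤ -Real.log t := neg_nonneg.mpr (Real.log_nonpos ht.1.le ht.2.le)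
    have := ht.1
    positivity
  refine ⟨hint, ?_⟩
  rw [intervalIntegral.integral_eq_sub_of_hasDerivAt_of_le zero_le_one hG hGd hint, hG0, hG1,
    sub_zero]

theorem intervalIntegrable_fun_sum {ι : Type*} (s : Finset ι) {f : ι → ℝ → ℝ} {a b : ℝ}
    (h : ∀ i ∈ s, IntervalIntegrable (f i) MeasureTheory.volume a b) :
    IntervalIntegrable (fun t => ∑ i ∈ s, f i t) MeasureTheory.volume a b := by
  simpa only [Finset.sum_fn] using IntervalIntegrable.sum s h

/-- The truncated exponential series of `-2 log t`. -/
noncomputable def truncExp (n : ℕ) (t : ℝ) : ℝ :=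
  ∑ m ∈ Finset.range (n + 1), (2 : ℝ) ^ m * ((-Real.log t) ^ m / (m.factorial : ℝ))

/-- The linearization of `singularCoeff` in the exponent of `2 ^ (-t)`. -/
noncomputable def linearCoeff (n : ℕ) (t : ℝ) : ℝ :=
  ∑ q ∈ Finset.HasAntidiagonal.antidiagonal n,
    (1 / 2 : ℝ) ^ q.1 * (1 - q.1 * Real.log 2 * t) *
      ((-Real.log t) ^ q.2 / (q.2.factorial : ℝ))

theorem intervalIntegrable_mul_truncExp (n : ℕ) :
    IntervalIntegrable (fun t => t * truncExp n t) MeasureTheory.volume 0 1 := by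
  have : (fun t => t * truncExp n t) = fun t => ∑ m ∈ Finset.range (n + 1),
      (2 : ℝ) ^ m * (t ^ 1 * ((-Real.log t) ^ m / (m.factorial : ℝ))) := by
    ext t
    rw [truncExp, Finset.mul_sum]
    exact Finset.sum_congr rfl fun m _ => by ring
  rw [this]
  exact intervalIntegrable_fun_sum _ fun m _ => ((integral_pow_mul_log_pow 1 m).1.const_mul _)

theorem integral_mul_truncExp (n : ℕ) :
    ∫ t in (0 : ℝ)..1, t * truncExp n t = ((n : ℝ) + 1) / 2 := by
  have : (fun t => t * truncExp n t) = fun t => ∑ m ∈ Finset.range (n + 1),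
      (2 : ℝ) ^ m * (t ^ 1 * ((-Real.log t) ^ m / (m.factorial : ℝ))) := by
    ext t
    rw [truncExp, Finset.mul_sum]
    exact Finset.sum_congr rfl fun m _ => by ring
  rw [this, intervalIntegral.integral_finsetSum
    fun m _ => ((integral_pow_mul_log_pow 1 m).1.const_mul _)]
  have h : ∀ m ∈ Finset.range (n + 1), (∫ t in (0 : ℝ)..1,
      (2 : ℝ) ^ m * (t ^ 1 * ((-Real.log t) ^ m / (m.factorial : ℝ)))) = 1 / 2 := by
    intro m _
    rw [intervalIntegral.integral_const_mul, (integral_pow_mul_log_pow 1 m).2, pow_succ]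
    norm_num
    field_simp
  rw [Finset.sum_congr rfl h]
  simp
  ring

theorem linearCoeff_integral (n : ℕ) :
    IntervalIntegrable (linearCoeff n) MeasureTheory.volume 0 1 ∧
    ∫ t in (0 : ℝ)..1, linearCoeff n t =
      2 - (1 / 2) ^ n - Real.log 2 / 4 * (1 / 2) ^ n * ((n : ℝ) * ((n : ℝ) + 1)) := by
  have hfun : linearCoeff n = fun t => ∑ q ∈ Finset.HasAntidiagonal.antidiagonal n,
      ((1 / 2 : ℝ) ^ q.1 * (t ^ 0 * ((-Real.log t) ^ q.2 / (q.2.factorial : ℝ))) -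
        (1 / 2 : ℝ) ^ q.1 * (q.1 * Real.log 2) *
          (t ^ 1 * ((-Real.log t) ^ q.2 / (q.2.factorial : ℝ)))) := by
    ext t
    exact Finset.sum_congr rfl fun q _ => by ring
  have hint : ∀ q ∈ Finset.HasAntidiagonal.antidiagonal n, IntervalIntegrable (fun t : ℝ =>
      ((1 / 2 : ℝ) ^ q.1 * (t ^ 0 * ((-Real.log t) ^ q.2 / (q.2.factorial : ℝ))) -
        (1 / 2 : ℝ) ^ q.1 * (q.1 * Real.log 2) *
          (t ^ 1 * ((-Real.log t) ^ q.2 / (q.2.factorial : ℝ))))) MeasureTheory.volume 0 1 :=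
    fun q _ => ((integral_pow_mul_log_pow 0 q.2).1.const_mul _).sub
      ((integral_pow_mul_log_pow 1 q.2).1.const_mul _)
  rw [hfun]
  refine ⟨intervalIntegrable_fun_sum _ hint, ?_⟩
  rw [intervalIntegral.integral_finsetSum hint]
  have h : ∀ q ∈ Finset.HasAntidiagonal.antidiagonal n, (∫ t in (0 : ℝ)..1,
      ((1 / 2 : ℝ) ^ q.1 * (t ^ 0 * ((-Real.log t) ^ q.2 / (q.2.factorial : ℝ))) -
        (1 / 2 : ℝ) ^ q.1 * (q.1 * Real.log 2) *
          (t ^ 1 * ((-Real.log t) ^ q.2 / (q.2.factorial : ℝ))))) =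
      (1 / 2 : ℝ) ^ q.1 - Real.log 2 / 2 * (1 / 2) ^ n * q.1 := by
    intro q hq
    rw [intervalIntegral.integral_sub ((integral_pow_mul_log_pow 0 q.2).1.const_mul _)
      ((integral_pow_mul_log_pow 1 q.2).1.const_mul _), intervalIntegral.integral_const_mul,
      intervalIntegral.integral_const_mul, (integral_pow_mul_log_pow 0 q.2).2,
      (integral_pow_mul_log_pow 1 q.2).2, ← Finset.HasAntidiagonal.mem_antidiagonal.mp hq]
    have h2 : ((((1 : ℕ) : ℝ) + 1) ^ (q.2 + 1))⁻¹ = 1 / 2 * (1 / 2) ^ q.2 := by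
      rw [← inv_pow, pow_succ]
      norm_num
      ring
    rw [h2, pow_add]
    simp
    ring
  rw [Finset.sum_congr rfl h, Finset.sum_sub_distrib, ← Finset.mul_sum,
    Finset.Nat.sum_antidiagonal_eq_sum_range_succ (fun i _ => (1 / 2 : ℝ) ^ i),
    Finset.Nat.sum_antidiagonal_eq_sum_range_succ (fun i _ => (i : ℝ))]
  have h3 : ∑ i ∈ Finset.range (n + 1), (1 / 2 : ℝ) ^ i = 2 - (1 / 2) ^ n := by
    rw [geom_sum_eq (by norm_num), pow_succ]
    ring
  have h4 : ∑ i ∈ Finset.range (n + 1), (i : ℝ) = (n : ℝ) * ((n : ℝ) + 1) / 2 := by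
    have := Finset.sum_range_id_mul_two (n + 1)
    have h5 : (∑ i ∈ Finset.range (n + 1), (i : ℝ)) * 2 = ((n : ℝ) + 1) * n := by
      rw [Nat.add_sub_cancel] at this
      simpa using congrArg (Nat.cast : ℕ → ℝ) this
    linarith
  rw [h3, h4]
  ring

/-! ### Pointwise comparison of `P_k(1 + t)` with its main term -/

theorem neg_log_nonneg {t : ℝ} (ht0 : 0 < t) (ht1 : t ≤ 1) : 0 ≤ -Real.log t :=
  neg_nonneg.mpr (Real.log_nonpos ht0.le ht1)

theorem truncExp_le {t : ℝ} (ht0 : 0 < t) (ht1 : t ≤ 1) (n : ℕ) : truncExp n t ≤ (t ^ 2)⁻¹ := by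
  have hL := neg_log_nonneg ht0 ht1
  have h := Real.sum_le_exp_of_nonneg (mul_nonneg zero_le_two hL) (n + 1)
  have h1 : Real.exp (2 * -Real.log t) = (t ^ 2)⁻¹ := by
    rw [mul_neg, Real.exp_neg, mul_comm, Real.exp_mul, Real.exp_log ht0]
    norm_num
  rw [h1] at h
  refine le_trans (le_of_eq (Finset.sum_congr rfl fun m _ => ?_)) h
  rw [mul_pow]
  ring

theorem truncExp_mono {t : ℝ} (ht0 : 0 < t) (ht1 : t ≤ 1) {n k : ℕ} (h : n ≤ k) :
    truncExp n t ≤ truncExp k t := by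
  have hL := neg_log_nonneg ht0 ht1
  exact Finset.sum_le_sum_of_subset_of_nonneg (Finset.range_mono (by omega))
    fun m _ _ => by positivity

theorem truncExp_nonneg {t : ℝ} (ht0 : 0 < t) (ht1 : t ≤ 1) (n : ℕ) : 0 ≤ truncExp n t := by
  have hL := neg_log_nonneg ht0 ht1
  exact Finset.sum_nonneg fun m _ => by positivity

theorem sum_antidiagonal_eq_truncExp (n : ℕ) (t : ℝ) :
    ∑ q ∈ Finset.HasAntidiagonal.antidiagonal n,
      (1 / 2 : ℝ) ^ q.1 * ((-Real.log t) ^ q.2 / (q.2.factorial : ℝ)) =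
      (1 / 2) ^ n * truncExp n t := by
  rw [truncExp, Finset.mul_sum, ← Finset.Nat.sum_antidiagonal_eq_sum_range_succ
    (fun m _ => (1 / 2 : ℝ) ^ n * ((2 : ℝ) ^ m * ((-Real.log t) ^ m / (m.factorial : ℝ)))),
    ← Finset.Nat.sum_antidiagonal_swap]
  refine Finset.sum_congr rfl fun q hq => ?_
  have h : (1 / 2 : ℝ) ^ n * 2 ^ q.1 = (1 / 2) ^ q.2 := by
    rw [← Finset.HasAntidiagonal.mem_antidiagonal.mp hq, pow_add, mul_right_comm, ← mul_pow]
    norm_num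
  simp only [Prod.fst_swap, Prod.snd_swap]
  rw [← mul_assoc, h]

theorem two_rpow_neg_pow (t : ℝ) (i : ℕ) :
    ((2 : ℝ) ^ (-(1 + t))) ^ i = (1 / 2) ^ i * (2 : ℝ) ^ (-((i : ℝ) * t)) := by
  rw [neg_add, Real.rpow_add two_pos, Real.rpow_neg_one, mul_pow, ← Real.rpow_natCast (2 ^ (-t)),
    ← Real.rpow_mul zero_le_two, one_div]
  congr 2
  ring

theorem singularCoeff_nonneg {t : ℝ} (ht0 : 0 < t) (ht1 : t ≤ 1) (n : ℕ) :
    0 ≤ singularCoeff n t := by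
  have hL := neg_log_nonneg ht0 ht1
  exact Finset.sum_nonneg fun m _ => by positivity

theorem singularCoeff_le {t : ℝ} (ht0 : 0 < t) (ht1 : t ≤ 1) (n : ℕ) :
    singularCoeff n t ≤ (1 / 2) ^ n * truncExp n t := by
  have hL := neg_log_nonneg ht0 ht1
  rw [← sum_antidiagonal_eq_truncExp]
  refine Finset.sum_le_sum fun q _ => mul_le_mul_of_nonneg_right ?_ (by positivity)
  rw [two_rpow_neg_pow]
  refine mul_le_of_le_one_right (by positivity) ?_
  refine Real.rpow_le_one_of_one_le_of_nonpos one_le_two ?_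
  have : 0 ≤ (q.1 : ℝ) * t := by positivity
  linarith

/-- The bound is quadratic for small `x` but only linear for large `x`. A purely quadratic one would
lead to an error `k ^ 2` instead of `k log (k + 1)`. -/
theorem abs_two_rpow_neg_sub_le {x : ℝ} (hx : 0 ≤ x) :
    |(2 : ℝ) ^ (-x) - (1 - x * Real.log 2)| ≤ 2 * x ^ 2 / (1 + x) := by
  have hl0 : 0 < Real.log 2 := Real.log_pos one_lt_two
  have hl1 : Real.log 2 ≤ 1 := by linarith [Real.log_two_lt_d9]
  set y := x * Real.log 2 with hy
  have hy0 : 0 ≤ y := by positivity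
  have hyx : y ≤ x := mul_le_of_le_one_right hx hl1
  have h2 : (2 : ℝ) ^ (-x) = Real.exp (-y) := by
    rw [Real.rpow_def_of_pos two_pos, hy]
    congr 1
    ring
  have hlow := Real.add_one_le_exp (-y)
  rw [h2, abs_of_nonneg (by linarith), le_div_iff₀ (by linarith)]
  rcases le_total x 1 with h | h
  · have h3 := Real.abs_exp_sub_one_sub_id_le (x := -y) (by rw [abs_neg, abs_of_nonneg hy0]; linarith)
    have h4 := (abs_le.mp h3).2
    have h5 : Real.exp (-y) - (1 - y) ≤ x ^ 2 := by nlinarith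
    nlinarith [sq_nonneg x]
  · have h3 : Real.exp (-y) ≤ 1 := Real.exp_le_one_iff.mpr (by linarith)
    have h5 : Real.exp (-y) - (1 - y) ≤ x := by linarith
    nlinarith

theorem sq_div_one_add_mono {x y : ℝ} (hx : 0 ≤ x) (hxy : x ≤ y) :
    2 * x ^ 2 / (1 + x) ≤ 2 * y ^ 2 / (1 + y) := by
  rw [div_le_div_iff₀ (by linarith) (by linarith)]
  have h1 : x ^ 2 ≤ y ^ 2 := pow_le_pow_left₀ hx hxy 2
  have h2 : x * y * x ≤ x * y * y := mul_le_mul_of_nonneg_left hxy (by nlinarith)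
  nlinarith

/-- The linearization error is at most `2 (k t) ^ 2 / (1 + k t)` for every exponent that occurs, and
`truncExp n t ≤ t ^ (-2)` cancels its factor `t ^ 2`. -/
theorem abs_singularCoeff_sub_linearCoeff_le {t : ℝ} (ht0 : 0 < t) (ht1 : t ≤ 1) {n k : ℕ}
    (hnk : n ≤ k) : |singularCoeff n t - linearCoeff n t| ≤
      (1 / 2) ^ n * (2 * (k : ℝ) ^ 2 / (1 + k * t)) := by
  have hL := neg_log_nonneg ht0 ht1
  set B := 2 * ((k : ℝ) * t) ^ 2 / (1 + k * t) with hB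
  have hB0 : 0 ≤ B := by positivity
  have h1 : |singularCoeff n t - linearCoeff n t| ≤ B * ((1 / 2) ^ n * truncExp n t) := by
    rw [← sum_antidiagonal_eq_truncExp, Finset.mul_sum, singularCoeff, linearCoeff,
      ← Finset.sum_sub_distrib]
    refine (Finset.abs_sum_le_sum_abs _ _).trans (Finset.sum_le_sum fun q hq => ?_)
    have hq' : (q.1 : ℝ) ≤ k := by
      have := Finset.HasAntidiagonal.mem_antidiagonal.mp hq
      exact_mod_cast (by omega : q.1 ≤ k)
    rw [two_rpow_neg_pow, ← sub_mul, ← mul_sub, abs_mul, abs_mul,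
      abs_of_nonneg (by positivity : (0 : ℝ) ≤ (1 / 2) ^ q.1),
      abs_of_nonneg (by positivity : 0 ≤ (-Real.log t) ^ q.2 / (q.2.factorial : ℝ))]
    have h2 := abs_two_rpow_neg_sub_le (x := q.1 * t) (by positivity)
    have h3 := sq_div_one_add_mono (x := q.1 * t) (y := k * t) (by positivity)
      (mul_le_mul_of_nonneg_right hq' ht0.le)
    rw [show (q.1 : ℝ) * Real.log 2 * t = q.1 * t * Real.log 2 by ring]
    calc _ ≤ (1 / 2 : ℝ) ^ q.1 * B * ((-Real.log t) ^ q.2 / (q.2.factorial : ℝ)) := by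
          gcongr
          exact h2.trans h3
      _ = _ := by ring
  refine h1.trans ?_
  have h2 : B * ((1 / 2) ^ n * truncExp n t) ≤ B * ((1 / 2) ^ n * (t ^ 2)⁻¹) := by
    gcongr
    exact truncExp_le ht0 ht1 n
  refine h2.trans (le_of_eq ?_)
  rw [hB]
  field_simp

theorem sum_antidiagonal_geometric_le (k : ℕ) :
    ∑ q ∈ Finset.HasAntidiagonal.antidiagonal k, (2 / 5 : ℝ) ^ q.1 * (1 / 2) ^ q.2 ≤
      5 * (1 / 2) ^ k := by
  have h : ∀ q ∈ Finset.HasAntidiagonal.antidiagonal k, (2 / 5 : ℝ) ^ q.1 * (1 / 2) ^ q.2 =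
      (4 / 5) ^ q.1 * (1 / 2) ^ k := by
    intro q hq
    rw [← Finset.HasAntidiagonal.mem_antidiagonal.mp hq, pow_add, ← mul_assoc, ← mul_pow]
    norm_num
  rw [Finset.sum_congr rfl h, ← Finset.sum_mul,
    Finset.Nat.sum_antidiagonal_eq_sum_range_succ (fun i _ => (4 / 5 : ℝ) ^ i)]
  refine mul_le_mul_of_nonneg_right ?_ (by positivity)
  rw [geom_sum_eq (by norm_num), Nat.succ_eq_add_one]
  have : (0 : ℝ) ≤ (4 / 5) ^ (k + 1) := by positivity
  have h2 : ((4 / 5 : ℝ) ^ (k + 1) - 1) / (4 / 5 - 1) = 5 - 5 * (4 / 5) ^ (k + 1) := by ring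
  linarith

/-- The main term of `almostPrimeZeta k (1 + t)` as `t → 0+`. -/
noncomputable def mainTerm (a : ℕ → ℝ) (k : ℕ) (t : ℝ) : ℝ :=
  ∑ q ∈ Finset.HasAntidiagonal.antidiagonal k, a q.1 * linearCoeff q.2 t

/-- Replacing `a'` by `a` costs a factor `t` times the singular coefficient. There `truncExp` is
kept, since `t * t ^ (-2)` would not be integrable at `0`, whereas `t * truncExp k t` has integral
`(k + 1) / 2`. -/
theorem abs_almostPrimeZeta_sub_mainTerm_le {a : ℕ → ℝ} {M : ℝ} (hM0 : 0 ≤ M)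
    (ha : ∀ j, |a j| ≤ M * (2 / 5) ^ j)
    (hat : ∀ t, 0 < t → t ≤ 1 → ∀ a', IsLogDerivSolution (logDerivCoeff t) a' →
      ∀ j, |a' j - a j| ≤ M * (2 / 5) ^ j * t)
    {t : ℝ} (ht0 : 0 < t) (ht1 : t ≤ 1) (k : ℕ) :
    |almostPrimeZeta k (1 + t) - mainTerm a k t| ≤
      5 * M * (1 / 2) ^ k * (t * truncExp k t + 2 * (k : ℝ) ^ 2 / (1 + k * t)) := by
  obtain ⟨a', ha', hk⟩ := exists_isLogDerivSolution ht0
  have hd := hat t ht0 ht1 a' ha'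
  set X := t * truncExp k t + 2 * (k : ℝ) ^ 2 / (1 + k * t) with hX
  have hE := truncExp_nonneg ht0 ht1 k
  have hX0 : 0 ≤ X := by positivity
  rw [hk, mainTerm, ← Finset.sum_sub_distrib]
  have hterm : ∀ q ∈ Finset.HasAntidiagonal.antidiagonal k,
      |a' q.1 * singularCoeff q.2 t - a q.1 * linearCoeff q.2 t| ≤
        (2 / 5 : ℝ) ^ q.1 * (1 / 2) ^ q.2 * (M * X) := by
    intro q hq
    have hq' : q.2 ≤ k := by
      have := Finset.HasAntidiagonal.mem_antidiagonal.mp hq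
      omega
    have h1 : a' q.1 * singularCoeff q.2 t - a q.1 * linearCoeff q.2 t =
        (a' q.1 - a q.1) * singularCoeff q.2 t +
          a q.1 * (singularCoeff q.2 t - linearCoeff q.2 t) := by ring
    rw [h1]
    refine (abs_add_le _ _).trans ?_
    rw [abs_mul, abs_mul, abs_of_nonneg (singularCoeff_nonneg ht0 ht1 q.2)]
    have h2 : singularCoeff q.2 t ≤ (1 / 2) ^ q.2 * truncExp k t :=
      (singularCoeff_le ht0 ht1 q.2).trans
        (mul_le_mul_of_nonneg_left (truncExp_mono ht0 ht1 hq') (by positivity))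
    calc |a' q.1 - a q.1| * singularCoeff q.2 t +
          |a q.1| * |singularCoeff q.2 t - linearCoeff q.2 t|
        ≤ (M * (2 / 5) ^ q.1 * t) * ((1 / 2) ^ q.2 * truncExp k t) +
          (M * (2 / 5) ^ q.1) * ((1 / 2) ^ q.2 * (2 * (k : ℝ) ^ 2 / (1 + k * t))) := by
          refine add_le_add ?_ ?_
          · exact mul_le_mul (hd q.1) h2 (singularCoeff_nonneg ht0 ht1 q.2) (by positivity)
          · exact mul_le_mul (ha q.1) (abs_singularCoeff_sub_linearCoeff_le ht0 ht1 hq')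
              (abs_nonneg _) (by positivity)
      _ = _ := by rw [hX]; ring
  refine (Finset.abs_sum_le_sum_abs _ _).trans ((Finset.sum_le_sum hterm).trans ?_)
  rw [← Finset.sum_mul]
  refine (mul_le_mul_of_nonneg_right (sum_antidiagonal_geometric_le k) (by positivity)).trans
    (le_of_eq (by ring))

/-- At `t = 1` the logarithm vanishes, and the singular coefficient is at most `2 ^ (-n)`. -/
theorem almostPrimeZeta_two_le {a : ℕ → ℝ} {M : ℝ} (hM0 : 0 ≤ M)
    (ha : ∀ j, |a j| ≤ M * (2 / 5) ^ j)
    (hat : ∀ t, 0 < t → t ≤ 1 → ∀ a', IsLogDerivSolution (logDerivCoeff t) a' →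
      ∀ j, |a' j - a j| ≤ M * (2 / 5) ^ j * t) (k : ℕ) :
    almostPrimeZeta k 2 ≤ 10 * M * (1 / 2) ^ k := by
  obtain ⟨a', ha', hk⟩ := exists_isLogDerivSolution one_pos
  have hd := hat 1 one_pos le_rfl a' ha'
  have hk2 := hk k
  rw [one_add_one_eq_two] at hk2
  rw [hk2]
  have hterm : ∀ q ∈ Finset.HasAntidiagonal.antidiagonal k,
      a' q.1 * singularCoeff q.2 1 ≤ (2 / 5 : ℝ) ^ q.1 * (1 / 2) ^ q.2 * (2 * M) := by
    intro q _
    have h1 : singularCoeff q.2 1 ≤ (1 / 2) ^ q.2 := by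
      refine (singularCoeff_le one_pos le_rfl q.2).trans ?_
      refine mul_le_of_le_one_right (by positivity) ?_
      simpa using truncExp_le one_pos le_rfl q.2
    have h2 : a' q.1 ≤ 2 * M * (2 / 5) ^ q.1 := by
      have h3 := (abs_le.mp (hd q.1)).2
      have h4 := (abs_le.mp (ha q.1)).2
      linarith
    calc a' q.1 * singularCoeff q.2 1 ≤ (2 * M * (2 / 5) ^ q.1) * (1 / 2) ^ q.2 :=
          mul_le_mul h2 h1 (singularCoeff_nonneg one_pos le_rfl q.2) (by positivity)
      _ = _ := by ring
  refine (Finset.sum_le_sum hterm).trans ?_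
  rw [← Finset.sum_mul]
  refine (mul_le_mul_of_nonneg_right (sum_antidiagonal_geometric_le k) (by positivity)).trans
    (le_of_eq (by ring))

/-! ### Integration over `0 < t ≤ 1` -/

theorem mainTerm_integral (a : ℕ → ℝ) (k : ℕ) :
    IntervalIntegrable (mainTerm a k) MeasureTheory.volume 0 1 ∧
    ∫ t in (0 : ℝ)..1, mainTerm a k t = ∑ q ∈ Finset.HasAntidiagonal.antidiagonal k,
      a q.1 * (2 - (1 / 2) ^ q.2 -
        Real.log 2 / 4 * (1 / 2) ^ q.2 * ((q.2 : ℝ) * ((q.2 : ℝ) + 1))) := by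
  have hi : ∀ q ∈ Finset.HasAntidiagonal.antidiagonal k, IntervalIntegrable
      (fun t => a q.1 * linearCoeff q.2 t) MeasureTheory.volume 0 1 :=
    fun q _ => (linearCoeff_integral q.2).1.const_mul _
  refine ⟨intervalIntegrable_fun_sum _ hi, ?_⟩
  simp only [mainTerm]
  rw [intervalIntegral.integral_finsetSum hi]
  refine Finset.sum_congr rfl fun q _ => ?_
  rw [intervalIntegral.integral_const_mul, (linearCoeff_integral q.2).2]

theorem integral_sq_div_one_add (k : ℕ) :
    IntervalIntegrable (fun t : ℝ => 2 * (k : ℝ) ^ 2 / (1 + k * t)) MeasureTheory.volume 0 1 ∧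
    ∫ t in (0 : ℝ)..1, 2 * (k : ℝ) ^ 2 / (1 + k * t) = 2 * k * Real.log (k + 1) := by
  have hpos : ∀ t ∈ Set.uIcc (0 : ℝ) 1, 0 < 1 + (k : ℝ) * t := by
    intro t ht
    rw [Set.uIcc_of_le zero_le_one] at ht
    have := ht.1
    positivity
  have hi : IntervalIntegrable (fun t : ℝ => 2 * (k : ℝ) ^ 2 / (1 + k * t))
      MeasureTheory.volume 0 1 := by
    refine ContinuousOn.intervalIntegrable ?_
    exact ContinuousOn.div (by fun_prop) (by fun_prop) fun t ht => (hpos t ht).ne'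
  refine ⟨hi, ?_⟩
  have hd : ∀ t ∈ Set.uIcc (0 : ℝ) 1, HasDerivAt (fun t : ℝ => 2 * k * Real.log (1 + k * t))
      (2 * (k : ℝ) ^ 2 / (1 + k * t)) t := by
    intro t ht
    have h1 : HasDerivAt (fun t : ℝ => 1 + (k : ℝ) * t) k t := by
      simpa using ((hasDerivAt_id t).const_mul (k : ℝ)).const_add 1
    refine ((h1.log (hpos t ht).ne').const_mul (2 * (k : ℝ))).congr_deriv ?_
    ring
  rw [intervalIntegral.integral_eq_sub_of_hasDerivAt hd hi]
  simp [add_comm]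

/-- Monotonicity supplies the measurability needed for integration. -/
theorem almostPrimeZeta_antitoneOn (k : ℕ) :
    AntitoneOn (fun t => almostPrimeZeta k (1 + t)) (Set.Ioc 0 1) := by
  intro t ht u hu htu
  refine (summable_almostPrime_rpow k (by linarith [hu.1])).tsum_le_tsum (fun n => ?_)
    (summable_almostPrime_rpow k (by linarith [ht.1]))
  rcases Nat.eq_zero_or_pos (n : ℕ) with h | h
  · rw [h, Nat.cast_zero, Real.zero_rpow (by linarith [hu.1]), Real.zero_rpow (by linarith [ht.1])]
  · exact Real.rpow_le_rpow_of_exponent_le (by exact_mod_cast h) (by linarith)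

theorem almostPrimeZeta_integral {a : ℕ → ℝ} {M : ℝ} (hM0 : 0 ≤ M)
    (ha : ∀ j, |a j| ≤ M * (2 / 5) ^ j)
    (hat : ∀ t, 0 < t → t ≤ 1 → ∀ a', IsLogDerivSolution (logDerivCoeff t) a' →
      ∀ j, |a' j - a j| ≤ M * (2 / 5) ^ j * t) (k : ℕ) :
    IntervalIntegrable (fun t => almostPrimeZeta k (1 + t)) MeasureTheory.volume 0 1 ∧
    |(∫ t in (0 : ℝ)..1, almostPrimeZeta k (1 + t)) - ∫ t in (0 : ℝ)..1, mainTerm a k t| ≤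
      5 * M * (1 / 2) ^ k * (((k : ℝ) + 1) / 2 + 2 * k * Real.log (k + 1)) := by
  set B : ℝ → ℝ := fun t =>
    5 * M * (1 / 2) ^ k * (t * truncExp k t + 2 * (k : ℝ) ^ 2 / (1 + k * t)) with hB
  have hle : ∀ t ∈ Set.Ioc (0 : ℝ) 1, |almostPrimeZeta k (1 + t) - mainTerm a k t| ≤ B t :=
    fun t ht => abs_almostPrimeZeta_sub_mainTerm_le hM0 ha hat ht.1 ht.2 k
  have hBi : IntervalIntegrable B MeasureTheory.volume 0 1 :=
    ((intervalIntegrable_mul_truncExp k).add (integral_sq_div_one_add k).1).const_mul _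
  have hBv : ∫ t in (0 : ℝ)..1, B t =
      5 * M * (1 / 2) ^ k * (((k : ℝ) + 1) / 2 + 2 * k * Real.log (k + 1)) := by
    simp only [hB]
    rw [intervalIntegral.integral_const_mul, intervalIntegral.integral_add
      (intervalIntegrable_mul_truncExp k) (integral_sq_div_one_add k).1, integral_mul_truncExp,
      (integral_sq_div_one_add k).2]
  have hmain := (mainTerm_integral a k).1
  have hint : IntervalIntegrable (fun t => almostPrimeZeta k (1 + t)) MeasureTheory.volume 0 1 := by
    have hdom : IntervalIntegrable (fun t => B t + |mainTerm a k t|) MeasureTheory.volume 0 1 :=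
      hBi.add hmain.abs
    rw [intervalIntegrable_iff_integrableOn_Ioc_of_le zero_le_one] at hdom ⊢
    refine hdom.mono'
      (aemeasurable_restrict_of_antitoneOn measurableSet_Ioc
        (almostPrimeZeta_antitoneOn k)).aestronglyMeasurable ?_
    refine (MeasureTheory.ae_restrict_iff' measurableSet_Ioc).mpr
      (Filter.Eventually.of_forall fun t ht => ?_)
    have h1 := hle t ht
    have h2 := abs_add_le (almostPrimeZeta k (1 + t) - mainTerm a k t) (mainTerm a k t)
    rw [sub_add_cancel] at h2
    rw [Real.norm_eq_abs]
    linarith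
  refine ⟨hint, ?_⟩
  rw [← intervalIntegral.integral_sub hint hmain, ← hBv, ← Real.norm_eq_abs]
  refine intervalIntegral.norm_integral_le_of_norm_le zero_le_one ?_ hBi
  exact Filter.Eventually.of_forall fun t ht => hle t ht

/-! ### From the integral to `f_k` -/

theorem integral_natCast_rpow {n : ℕ} (hn : 2 ≤ n) :
    ∫ t in (0 : ℝ)..1, (n : ℝ) ^ (-(1 + t)) =
      1 / ((n : ℝ) * Real.log n) - (n : ℝ) ^ (-2 : ℝ) / Real.log n := by
  have hn0 : (0 : ℝ) < n := by exact_mod_cast (by omega : 0 < n)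
  have hl : 0 < Real.log n := Real.log_pos (by exact_mod_cast (by omega : 1 < n))
  have hd : ∀ t ∈ Set.uIcc (0 : ℝ) 1, HasDerivAt (fun t : ℝ => -((n : ℝ) ^ (-(1 + t)) / Real.log n))
      ((n : ℝ) ^ (-(1 + t))) t := by
    intro t _
    have h1 : HasDerivAt (fun t : ℝ => -(1 + t)) (-1) t := ((hasDerivAt_id t).const_add 1).fun_neg
    refine ((h1.const_rpow hn0).div_const (Real.log n)).fun_neg.congr_deriv ?_
    field_simp
  have hc : Continuous fun t : ℝ => (n : ℝ) ^ (-(1 + t)) :=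
    Continuous.rpow continuous_const (by fun_prop) fun _ => Or.inl hn0.ne'
  rw [intervalIntegral.integral_eq_sub_of_hasDerivAt hd (hc.intervalIntegrable _ _)]
  have h2 : (n : ℝ) ^ (-(1 + 0) : ℝ) = (n : ℝ)⁻¹ := by rw [add_zero, Real.rpow_neg_one]
  have h3 : (n : ℝ) ^ (-(1 + 1) : ℝ) = (n : ℝ) ^ (-2 : ℝ) := by norm_num
  rw [h2, h3]
  field_simp
  ring

/-- The term `τ` is the part of the integral over `s > 2`. Integrability of `P_k` near `s = 1`
bounds the partial sums of the integrated terms, so it also yields the convergence of `f_k`. -/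
theorem erdosSum_eq_integral_add {k : ℕ} (hk : 1 ≤ k)
    (hint : IntervalIntegrable (fun t => almostPrimeZeta k (1 + t)) MeasureTheory.volume 0 1) :
    Summable (erdosTerm k) ∧ ∃ τ : ℝ, 0 ≤ τ ∧ τ ≤ almostPrimeZeta k 2 / Real.log 2 ∧
      erdosSum k = (∫ t in (0 : ℝ)..1, almostPrimeZeta k (1 + t)) + τ := by
  have hn2 : ∀ n : {n : ℕ // ArithmeticFunction.cardFactors n = k}, 2 ≤ (n : ℕ) := by
    rintro ⟨n, hn⟩
    by_contra h
    have : n = 0 ∨ n = 1 := by simp only at h; omega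
    rcases this with rfl | rfl <;> simp at hn <;> omega
  have hl2 : 0 < Real.log 2 := Real.log_pos one_lt_two
  have hlog : ∀ n : {n : ℕ // ArithmeticFunction.cardFactors n = k},
      Real.log 2 ≤ Real.log (n : ℕ) := fun n =>
    Real.log_le_log two_pos (by exact_mod_cast hn2 n)
  set τ : {n : ℕ // ArithmeticFunction.cardFactors n = k} → ℝ := fun n =>
    ((n : ℕ) : ℝ) ^ (-2 : ℝ) / Real.log (n : ℕ) with hτ
  have hτ0 : ∀ n, 0 ≤ τ n := fun n => div_nonneg (by positivity) (hl2.le.trans (hlog n))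
  have hτle : ∀ n, τ n ≤ ((n : ℕ) : ℝ) ^ (-2 : ℝ) / Real.log 2 := fun n =>
    div_le_div_of_nonneg_left (by positivity) hl2 (hlog n)
  have hs2 := (summable_almostPrime_rpow k one_lt_two).div_const (Real.log 2)
  have hτs : Summable τ := hs2.of_nonneg_of_le hτ0 hτle
  set F : {n : ℕ // ArithmeticFunction.cardFactors n = k} → ℝ → ℝ := fun n t =>
    ((n : ℕ) : ℝ) ^ (-(1 + t)) with hF
  have hFc : ∀ n, Continuous (F n) := fun n =>
    Continuous.rpow continuous_const (by fun_prop) fun _ => Or.inl (by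
      have := hn2 n
      exact_mod_cast (by omega : (n : ℕ) ≠ 0))
  have hFI : ∀ n, IntervalIntegrable (F n) MeasureTheory.volume 0 1 := fun n =>
    (hFc n).intervalIntegrable _ _
  have hFi : ∀ n, MeasureTheory.Integrable (F n)
      (MeasureTheory.volume.restrict (Set.Ioc (0 : ℝ) 1)) := fun n =>
    (intervalIntegrable_iff_integrableOn_Ioc_of_le zero_le_one).mp (hFI n)
  have hF0 : ∀ n t, 0 ≤ F n t := fun n t => by positivity
  have hsum : Summable fun n => ∫ t in (0 : ℝ)..1, F n t := by
    refine summable_of_sum_le (c := ∫ t in (0 : ℝ)..1, almostPrimeZeta k (1 + t))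
      (fun n => intervalIntegral.integral_nonneg zero_le_one fun t _ => hF0 n t) fun S => ?_
    rw [← intervalIntegral.integral_finsetSum fun n _ => hFI n]
    refine intervalIntegral.integral_mono_on_of_le_Ioo zero_le_one
      (intervalIntegrable_fun_sum _ fun n _ => hFI n) hint fun t ht => ?_
    exact (summable_almostPrime_rpow k (by linarith [ht.1])).sum_le_tsum S fun n _ => hF0 n t
  have hhas : HasSum (fun n => ∫ t in (0 : ℝ)..1, F n t)
      (∫ t in (0 : ℝ)..1, almostPrimeZeta k (1 + t)) := by
    have := MeasureTheory.hasSum_integral_of_summable_integral_norm hFi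
      (hsum.congr fun n => by
        rw [intervalIntegral.integral_of_le zero_le_one]
        exact MeasureTheory.integral_congr_ae
          (Filter.Eventually.of_forall fun t => (Real.norm_of_nonneg (hF0 n t)).symm))
    simp_rw [intervalIntegral.integral_of_le zero_le_one]
    exact this
  have heq : ∀ n, (∫ t in (0 : ℝ)..1, F n t) + τ n = erdosTerm k n := fun n => by
    simp only [hF]
    rw [integral_natCast_rpow (hn2 n), erdosTerm, hτ]
    ring
  have htot := (hhas.add hτs.hasSum).congr_fun fun n => (heq n).symm
  refine ⟨htot.summable, ∑' n, τ n, tsum_nonneg hτ0, ?_, htot.tsum_eq⟩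
  rw [almostPrimeZeta, ← tsum_div_const]
  exact hτs.tsum_le_tsum hτle hs2

/-! ### The asymptotic formula -/

theorem erdosSum_asymptotic : (∀ k : ℕ, 1 ≤ k → Summable (erdosTerm k)) ∧
    ∃ C : ℝ, ∀ k : ℕ, 1 ≤ k →
      |erdosSum k - (1 - Real.log 2 / 4 * (1 / 2) ^ k * (dConst * (k : ℝ) ^ 2))| ≤
        C * (1 / 2) ^ k * ((k : ℝ) * Real.log ((k : ℝ) + 1)) := by
  obtain ⟨a, M, hM0, ha, hat, ha1, ha2⟩ := exists_limit_coeff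
  refine ⟨fun k hk => (erdosSum_eq_integral_add hk
    (almostPrimeZeta_integral hM0 ha hat k).1).1, ?_⟩
  set T := ∑' n : ℕ, ((n : ℝ) + 1) * (4 / 5 : ℝ) ^ n with hT
  have hTs := summable_succ_mul_geometric (r := 4 / 5) (by norm_num) (by norm_num)
  have hT0 : 0 ≤ T := tsum_nonneg fun n => by positivity
  have ha2le : ∀ j, |a j * 2 ^ j| ≤ M * (4 / 5) ^ j := fun j => by
    rw [abs_mul, abs_of_nonneg (by positivity : (0 : ℝ) ≤ 2 ^ j)]
    calc |a j| * 2 ^ j ≤ M * (2 / 5) ^ j * 2 ^ j :=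
          mul_le_mul_of_nonneg_right (ha j) (by positivity)
      _ = M * ((2 / 5) * 2) ^ j := by rw [mul_pow]; ring
      _ = _ := by norm_num
  have hs1 : Summable a := Summable.of_norm_bounded
    ((summable_geometric_of_lt_one (by norm_num) (by norm_num)).mul_left M) ha
  have hgs : Summable fun j : ℕ => (4 / 5 : ℝ) ^ j :=
    summable_geometric_of_lt_one (by norm_num) (by norm_num)
  have hs2 : Summable fun j => a j * 2 ^ j := Summable.of_norm_bounded (hgs.mul_left M) ha2le
  -- With `Y = k log (k + 1)` one has `1 ≤ k ≤ 2 Y`. The integrated error costs `10 Y + 10 Y`, the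
  -- constants `20 + 2 + 5 = 27` cost `54 Y`, and the passage from `(k - j) (k - j + 1)` to `k ^ 2`
  -- costs `4 T Y`.
  refine ⟨M * (74 + 4 * T), fun k hk => ?_⟩
  have hk1 : (1 : ℝ) ≤ k := by exact_mod_cast hk
  have hl2 : 1 / 2 ≤ Real.log 2 := by linarith [Real.log_two_gt_d9]
  have hl2' : Real.log 2 ≤ 1 := by linarith [Real.log_two_lt_d9]
  have hlk : Real.log 2 ≤ Real.log ((k : ℝ) + 1) := Real.log_le_log two_pos (by linarith)
  set Y := (k : ℝ) * Real.log ((k : ℝ) + 1) with hY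
  have hkY : (k : ℝ) ≤ 2 * Y := by
    rw [hY]
    nlinarith
  set h : ℝ := (1 / 2) ^ k with hh
  have hh0 : 0 < h := by positivity
  obtain ⟨hint, hI⟩ := almostPrimeZeta_integral hM0 ha hat k
  obtain ⟨-, τ, hτ0, hτ, hf⟩ := erdosSum_eq_integral_add hk hint
  rw [(mainTerm_integral a k).2] at hI
  have hτ' : τ ≤ 20 * M * h := by
    refine hτ.trans ?_
    rw [div_le_iff₀ (by linarith)]
    have h1 := almostPrimeZeta_two_le hM0 ha hat k
    have h2 : 0 ≤ M * h := by positivity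
    rw [← hh] at h1
    nlinarith
  have hS : ∑ q ∈ Finset.HasAntidiagonal.antidiagonal k, a q.1 * (2 - (1 / 2) ^ q.2 -
        Real.log 2 / 4 * (1 / 2) ^ q.2 * ((q.2 : ℝ) * ((q.2 : ℝ) + 1))) =
      2 * ∑ j ∈ Finset.range (k + 1), a j - h * ∑ j ∈ Finset.range (k + 1), a j * 2 ^ j -
        Real.log 2 / 4 * h * ∑ j ∈ Finset.range (k + 1),
          a j * 2 ^ j * (((k - j : ℕ) : ℝ) * (((k - j : ℕ) : ℝ) + 1)) := by
    rw [Finset.Nat.sum_antidiagonal_eq_sum_range_succ (fun i n => a i * (2 - (1 / 2) ^ n -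
        Real.log 2 / 4 * (1 / 2) ^ n * ((n : ℝ) * ((n : ℝ) + 1)))), Finset.mul_sum,
      Finset.mul_sum, Finset.mul_sum, ← Finset.sum_sub_distrib, ← Finset.sum_sub_distrib]
    refine Finset.sum_congr rfl fun j hj => ?_
    have hjk : j ≤ k := by simpa [Nat.lt_succ_iff] using hj
    have h1 : (1 / 2 : ℝ) ^ (k - j) = h * 2 ^ j := by
      have : h = (1 / 2 : ℝ) ^ (k - j) * (1 / 2) ^ j := by
        rw [hh, ← pow_add, Nat.sub_add_cancel hjk]
      rw [this, mul_assoc, ← mul_pow]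
      norm_num
    rw [h1]
    ring
  rw [hS] at hI
  have hA : |2 * ∑ j ∈ Finset.range (k + 1), a j - 1| ≤ 2 * M * h := by
    have h1 := hs1.sum_add_tsum_nat_add (k + 1)
    have h2 : |∑' j, a (j + (k + 1))| ≤ M * (2 / 5) ^ (k + 1) * (5 / 3) := by
      have h3 : HasSum (fun j : ℕ => M * (2 / 5) ^ (k + 1) * (2 / 5 : ℝ) ^ j)
          (M * (2 / 5) ^ (k + 1) * (5 / 3)) := by
        have := (hasSum_geometric_of_lt_one (r := (2 / 5 : ℝ)) (by norm_num)
          (by norm_num)).mul_left (M * (2 / 5) ^ (k + 1))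
        norm_num at this ⊢
        exact this
      rw [← Real.norm_eq_abs]
      refine tsum_of_norm_bounded h3 fun j => (ha _).trans (le_of_eq ?_)
      rw [pow_add]
      ring
    have h4 : (2 / 5 : ℝ) ^ (k + 1) * (5 / 3) ≤ h := by
      have : (2 / 5 : ℝ) ^ k ≤ h := pow_le_pow_left₀ (by norm_num) (by norm_num) k
      rw [pow_succ]
      have : (0 : ℝ) ≤ (2 / 5) ^ k := by positivity
      linarith
    have h5 : 2 * ∑ j ∈ Finset.range (k + 1), a j - 1 = -(2 * ∑' j, a (j + (k + 1))) := by
      rw [ha1] at h1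
      linarith
    rw [h5, abs_neg, abs_mul, abs_two]
    have h6 := mul_le_mul_of_nonneg_left h4 hM0
    linarith
  have hB : |∑ j ∈ Finset.range (k + 1), a j * 2 ^ j| ≤ 5 * M := by
    refine (Finset.abs_sum_le_sum_abs _ _).trans
      ((Finset.sum_le_sum fun j _ => ha2le j).trans ?_)
    rw [← Finset.mul_sum, mul_comm]
    refine mul_le_mul_of_nonneg_right ?_ hM0
    refine (hgs.sum_le_tsum _ fun _ _ => by positivity).trans ?_
    rw [tsum_geometric_of_lt_one (by norm_num) (by norm_num)]
    norm_num
  have hC : |∑ j ∈ Finset.range (k + 1),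
      a j * 2 ^ j * (((k - j : ℕ) : ℝ) * (((k - j : ℕ) : ℝ) + 1)) - dConst * (k : ℝ) ^ 2| ≤
      2 * k * M * T := by
    -- Truncated subtraction makes `w j` vanish for `j ≥ k`, so the finite sum is a full series and
    -- can be compared termwise with `k ^ 2 ∑ a_j 2 ^ j`.
    set w : ℕ → ℝ := fun j => ((k - j : ℕ) : ℝ) * (((k - j : ℕ) : ℝ) + 1) with hw
    have hw0 : ∀ j ∉ Finset.range (k + 1), a j * 2 ^ j * w j = 0 := fun j hj => by
      have : k - j = 0 := by
        have := Finset.mem_range.not.mp hj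
        omega
      simp [hw, this]
    have h1 : HasSum (fun j => a j * 2 ^ j * w j)
        (∑ j ∈ Finset.range (k + 1), a j * 2 ^ j * w j) := hasSum_sum_of_ne_finset_zero hw0
    have h2 : HasSum (fun j => a j * 2 ^ j * (k : ℝ) ^ 2) (dConst * (k : ℝ) ^ 2) := by
      rw [← ha2]
      exact hs2.hasSum.mul_right _
    have hwk : ∀ j, |w j - (k : ℝ) ^ 2| ≤ 2 * k * ((j : ℝ) + 1) := by
      intro j
      have hj0 : (0 : ℝ) ≤ j := Nat.cast_nonneg j
      rw [abs_le]
      rcases le_total j k with hj | hj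
      · have hjk : (j : ℝ) ≤ k := by exact_mod_cast hj
        simp only [hw]
        rw [Nat.cast_sub hj]
        constructor <;> nlinarith
      · have hjk : (k : ℝ) ≤ j := by exact_mod_cast hj
        have : k - j = 0 := by omega
        simp only [hw, this]
        constructor
        · push_cast
          nlinarith
        · push_cast
          nlinarith
    rw [← (h1.sub h2).tsum_eq, ← Real.norm_eq_abs]
    refine tsum_of_norm_bounded (hTs.hasSum.mul_left (2 * k * M)) fun j => ?_
    rw [← mul_sub, norm_mul, Real.norm_eq_abs, Real.norm_eq_abs]
    calc |a j * 2 ^ j| * |w j - (k : ℝ) ^ 2|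
        ≤ (M * (4 / 5) ^ j) * (2 * k * ((j : ℝ) + 1)) :=
          mul_le_mul (ha2le j) (hwk j) (abs_nonneg _) (by positivity)
      _ = _ := by ring
  generalize ∑ j ∈ Finset.range (k + 1), a j = s₁ at *
  generalize ∑ j ∈ Finset.range (k + 1), a j * 2 ^ j = s₂ at *
  generalize ∑ j ∈ Finset.range (k + 1),
      a j * 2 ^ j * (((k - j : ℕ) : ℝ) * (((k - j : ℕ) : ℝ) + 1)) = s₃ at *
  generalize (∫ t in (0 : ℝ)..1, almostPrimeZeta k (1 + t)) = I at *
  have hid : erdosSum k - (1 - Real.log 2 / 4 * h * (dConst * (k : ℝ) ^ 2)) =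
      (I - (2 * s₁ - h * s₂ - Real.log 2 / 4 * h * s₃)) + τ + (2 * s₁ - 1) - h * s₂ -
        Real.log 2 / 4 * h * (s₃ - dConst * (k : ℝ) ^ 2) := by
    rw [hf]
    ring
  have hB' : |h * s₂| ≤ 5 * M * h := by
    rw [abs_mul, abs_of_pos hh0]
    nlinarith
  have hC' : |Real.log 2 / 4 * h * (s₃ - dConst * (k : ℝ) ^ 2)| ≤ 2 * k * M * T * h := by
    have hc0 : 0 ≤ Real.log 2 / 4 * h := by positivity
    rw [abs_mul, abs_of_nonneg hc0]
    have h1 : Real.log 2 / 4 * h ≤ h := mul_le_of_le_one_left hh0.le (by linarith)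
    calc _ ≤ h * (2 * k * M * T) := mul_le_mul h1 hC (abs_nonneg _) hh0.le
      _ = _ := by ring
  have htri : |erdosSum k - (1 - Real.log 2 / 4 * h * (dConst * (k : ℝ) ^ 2))| ≤
      5 * M * h * (((k : ℝ) + 1) / 2 + 2 * k * Real.log (k + 1)) + 20 * M * h + 2 * M * h +
        5 * M * h + 2 * k * M * T * h := by
    rw [hid, abs_le]
    have hI' := abs_le.mp hI
    have hA' := abs_le.mp hA
    have hB'' := abs_le.mp hB'
    have hC'' := abs_le.mp hC'
    have hMh : 0 ≤ M * h := by positivity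
    constructor <;> linarith
  refine htri.trans ?_
  have hfin : 5 * (((k : ℝ) + 1) / 2 + 2 * k * Real.log (k + 1)) + 27 + 2 * k * T ≤
      (74 + 4 * T) * Y := by
    have h1 : 2 * k * Real.log ((k : ℝ) + 1) = 2 * Y := by rw [hY]; ring
    have h2 : (k : ℝ) * T ≤ 2 * Y * T := mul_le_mul_of_nonneg_right hkY hT0
    rw [h1]
    linarith
  calc _ = M * h * (5 * (((k : ℝ) + 1) / 2 + 2 * k * Real.log (k + 1)) + 27 + 2 * k * T) := by
        ring
    _ ≤ M * h * ((74 + 4 * T) * Y) := mul_le_mul_of_nonneg_left hfin (by positivity)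
    _ = _ := by ring

/-! ### The numerical value of `d` -/

/-- The relative deviation of `oddEulerFactor p` from `(1 - p⁻²)⁻¹`. -/
noncomputable def eulerDeviation (n : ℕ) : ℝ := (2 * (n : ℝ) - 1) / ((n : ℝ) ^ 3 * ((n : ℝ) - 2))

theorem eulerDeviation_nonneg {n : ℕ} (hn : 2 < n) : 0 ≤ eulerDeviation n := by
  have : (3 : ℝ) ≤ n := by exact_mod_cast hn
  exact div_nonneg (by linarith) (mul_nonneg (by positivity) (by linarith))

/-- The telescoping majorant `1 / (2 (x - 2) ^ 2)`. -/
noncomputable def deviationMajorant (x : ℝ) : ℝ := 1 / (2 * (x - 2) ^ 2)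

theorem eulerDeviation_le {n : ℕ} (hn : 2 < n) :
    eulerDeviation n ≤ deviationMajorant n - deviationMajorant (n + 2) := by
  have h3 : (3 : ℝ) ≤ n := by exact_mod_cast hn
  obtain ⟨y, hy⟩ : ∃ y : ℝ, y = (n : ℝ) - 2 := ⟨_, rfl⟩
  have hy1 : 1 ≤ y := by linarith
  have hn' : (n : ℝ) = y + 2 := by linarith
  rw [eulerDeviation, deviationMajorant, deviationMajorant, hn']
  have h1 : 1 / (2 * (y + 2 - 2) ^ 2) - 1 / (2 * (y + 2 + 2 - 2) ^ 2) =
      (2 * (y + 1)) / (y ^ 2 * (y + 2) ^ 2) := by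
    rw [show y + 2 - 2 = y by ring, show y + 2 + 2 - 2 = y + 2 by ring]
    field_simp
    ring
  rw [h1, div_le_div_iff₀ (mul_pos (by positivity) (by linarith)) (by positivity),
    show y + 2 - 2 = y by ring]
  have h2 : 0 ≤ y * (y + 2) ^ 2 := by positivity
  -- This product is the difference of the two sides after cross-multiplication.
  have h4 : 0 ≤ y * (y + 2) ^ 2 * (y * (4 - 1) + 4) := by positivity
  nlinarith

/-- The logarithm of `1 + eulerDeviation n` at odd primes, zero elsewhere. -/
noncomputable def logDeviation (n : ℕ) : ℝ :=
  if n.Prime ∧ 2 < n then Real.log (1 + eulerDeviation n) else 0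

theorem logDeviation_nonneg (n : ℕ) : 0 ≤ logDeviation n := by
  unfold logDeviation
  split_ifs with h
  · exact Real.log_nonneg (by linarith [eulerDeviation_nonneg h.2])
  · exact le_rfl

/-- The majorant telescopes in steps of two, as only odd numbers contribute. The sequence `V` drops
from the value at `n` to that at `n + 2` when `n = i + m` is odd, and is constant across even `n`.
-/
theorem sum_logDeviation_le (m N : ℕ) (hm : Odd m) (hm2 : 2 < m) :
    ∑ i ∈ Finset.range N, logDeviation (i + m) ≤ deviationMajorant m := by
  set V : ℕ → ℝ := fun i => if Even i then deviationMajorant ((i + m : ℕ) : ℝ)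
    else deviationMajorant ((i + m : ℕ) + 1 : ℝ) with hV
  have hV0 : ∀ i, 0 ≤ V i := fun i => by
    simp only [hV, deviationMajorant]
    split_ifs <;> positivity
  have hstep : ∀ i, logDeviation (i + m) ≤ V i - V (i + 1) := by
    intro i
    by_cases hi : Even i
    · simp only [hV, if_pos hi, if_neg (Nat.not_even_iff_odd.mpr hi.add_one)]
      have h1 := eulerDeviation_le (n := i + m) (by omega)
      have h2 : (((i + 1 + m : ℕ) : ℝ) + 1) = ((i + m : ℕ) : ℝ) + 2 := by push_cast; ring
      rw [h2]
      refine le_trans ?_ h1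
      have h3 := eulerDeviation_nonneg (n := i + m) (by omega)
      unfold logDeviation
      split_ifs with hp
      · linarith [Real.log_le_sub_one_of_pos (by linarith : 0 < 1 + eulerDeviation (i + m))]
      · exact h3
    · have hodd := Nat.not_even_iff_odd.mp hi
      have h0 : logDeviation (i + m) = 0 := by
        rw [logDeviation, if_neg]
        rintro ⟨hp, h2⟩
        exact (Nat.not_even_iff_odd.mpr (hp.odd_of_ne_two (by omega))) (hodd.add_odd hm)
      simp only [hV, if_neg hi, if_pos hodd.add_one]
      rw [h0]
      have h2 : ((i + 1 + m : ℕ) : ℝ) = ((i + m : ℕ) : ℝ) + 1 := by push_cast; ring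
      rw [h2, sub_self]
  calc ∑ i ∈ Finset.range N, logDeviation (i + m)
      ≤ ∑ i ∈ Finset.range N, (V i - V (i + 1)) := Finset.sum_le_sum fun i _ => hstep i
    _ = V 0 - V N := Finset.sum_range_sub' V N
    _ ≤ V 0 := by linarith [hV0 N]
    _ = _ := by simp [hV]

theorem summable_logDeviation : Summable logDeviation :=
  (summable_nat_add_iff 3).mp (summable_of_sum_range_le (fun _ => logDeviation_nonneg _)
    fun N => sum_logDeviation_le 3 N (by decide) (by norm_num))

theorem oddEulerFactor_eq (p : OddPrime) : Real.log (oddEulerFactor p) =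
    -Real.log (1 - ((p : ℕ) : ℝ) ^ (-2 : ℝ)) + logDeviation p := by
  have hp := p.three_le
  have h0 : (0 : ℝ) < (p : ℕ) := by linarith
  have hd := eulerDeviation_nonneg p.2.2
  have h2 : ((p : ℕ) : ℝ) ^ (-2 : ℝ) = 1 / ((p : ℕ) : ℝ) ^ 2 := by
    rw [Real.rpow_neg h0.le, one_div]
    norm_num
  have h3 : 0 < 1 - 1 / ((p : ℕ) : ℝ) ^ 2 := by
    rw [sub_pos, div_lt_one (by positivity)]
    nlinarith
  rw [logDeviation, if_pos p.2, h2, ← Real.log_inv, ← Real.log_mul (inv_pos.mpr h3).ne'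
    (by linarith), oddEulerFactor, eulerDeviation]
  congr 1
  generalize ((p : ℕ) : ℝ) = x at *
  have h4 : x - 2 ≠ 0 := by intro h; linarith
  have h5 : x ^ 2 - 1 ≠ 0 := by nlinarith
  have h6 : 1 - 2 / x ≠ 0 := by
    rw [show 1 - 2 / x = (x - 2) / x by field_simp]
    exact div_ne_zero h4 h0.ne'
  have h7 : 1 - 2 / x = (x - 2) / x := by field_simp
  have h8 : 1 - 1 / x = (x - 1) / x := by field_simp
  have h9 : 1 - 1 / x ^ 2 = (x ^ 2 - 1) / x ^ 2 := by field_simp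
  rw [h7, h8, h9]
  field_simp
  ring

/-- The product of `(1 - p ^ (-2))⁻¹` over odd primes is `(3 / 4) ζ(2) = π ^ 2 / 8`. Extracting it
leaves a product that converges fast enough for a short computation. -/
theorem dConst_eq : dConst = Real.pi ^ 2 / 32 * Real.exp (∑' n, logDeviation n) := by
  have hs : Summable fun p : OddPrime => logDeviation p := summable_oddPrime summable_logDeviation
  have hl : Summable fun p : OddPrime => -Real.log (1 - ((p : ℕ) : ℝ) ^ (-2 : ℝ)) :=
    (summable_log_primes one_lt_two).comp_injective
      (i := fun p : OddPrime => (⟨p, p.2.1⟩ : Nat.Primes)) fun p q h => by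
        simpa [Subtype.ext_iff] using h
  have h1 := log_zeta_eq one_lt_two
  rw [tsum_primes_eq_add_tsum_oddPrime (fun p => -Real.log (1 - (p : ℝ) ^ (-2 : ℝ)))
    (summable_log_primes one_lt_two)] at h1
  have hz : ∑' n : ℕ, (n : ℝ) ^ (-2 : ℝ) = Real.pi ^ 2 / 6 := by
    rw [← hasSum_zeta_two.tsum_eq]
    refine tsum_congr fun n => ?_
    rw [Real.rpow_neg (Nat.cast_nonneg n), one_div]
    norm_num
  have h2 : ∑' p : OddPrime, logDeviation p = ∑' n, logDeviation n := by
    rw [tsum_subtype_eq_tsum_ite (fun p => p.Prime ∧ 2 < p) logDeviation]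
    refine tsum_congr fun n => ?_
    by_cases h : n.Prime ∧ 2 < n
    · rw [if_pos h]
    · rw [if_neg h, logDeviation, if_neg h]
  rw [dConst, ← Real.rexp_tsum_eq_tprod oddEulerFactor_pos summable_log_oddEulerFactor,
    tsum_congr oddEulerFactor_eq, hl.tsum_add hs, h2, Real.exp_add]
  rw [hz] at h1
  have h3 : ∑' p : OddPrime, -Real.log (1 - ((p : ℕ) : ℝ) ^ (-2 : ℝ)) =
      Real.log (Real.pi ^ 2 / 8) := by
    have h4 : Real.log (Real.pi ^ 2 / 8) = Real.log (Real.pi ^ 2 / 6) + Real.log (3 / 4) := by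
      have := Real.pi_pos
      rw [← Real.log_mul (by positivity) (by norm_num)]
      congr 1
      ring
    have h5 : (1 : ℝ) - ((2 : ℕ) : ℝ) ^ (-2 : ℝ) = 3 / 4 := by
      rw [Real.rpow_neg (by norm_num)]
      norm_num
    rw [h5] at h1
    linarith
  rw [h3, Real.exp_log (by have := Real.pi_pos; positivity)]
  ring

/-- The odd primes below `201`. -/
def smallOddPrimes : List ℕ :=
  [3, 5, 7, 11, 13, 17, 19, 23, 29, 31, 37, 41, 43, 47, 53, 59, 61, 67, 71, 73, 79, 83, 89,
    97, 101, 103, 107, 109, 113, 127, 131, 137, 139, 149, 151, 157, 163, 167, 173, 179, 181,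
    191, 193, 197, 199]

theorem exp_sum_logDeviation : Real.exp (∑ n ∈ Finset.range 201, logDeviation n) =
    (smallOddPrimes.map fun n => 1 + eulerDeviation n).prod := by
  have hset : (Finset.range 201).filter (fun n => n.Prime ∧ 2 < n) = smallOddPrimes.toFinset := by
    decide +kernel
  have hnd : smallOddPrimes.Nodup := by decide +kernel
  rw [← List.prod_toFinset _ hnd, ← hset, Finset.prod_filter, Real.exp_sum]
  refine Finset.prod_congr rfl fun n _ => ?_
  unfold logDeviation
  split_ifs with h
  · exact Real.exp_log (by linarith [eulerDeviation_nonneg h.2])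
  · exact Real.exp_zero

theorem smallOddPrimes_prod_bounds :
    (1.22782 : ℝ) < (smallOddPrimes.map fun n => 1 + eulerDeviation n).prod ∧
      (smallOddPrimes.map fun n => 1 + eulerDeviation n).prod < (1.22783 : ℝ) := by
  simp only [smallOddPrimes, List.map_cons, List.map_nil, List.prod_cons, List.prod_nil,
    eulerDeviation]
  constructor <;> norm_num

theorem dConst_bounds : (0.37869 : ℝ) ≤ dConst ∧ dConst < (0.37870 : ℝ) := by
  obtain ⟨hlo, hhi⟩ := smallOddPrimes_prod_bounds
  rw [← exp_sum_logDeviation] at hlo hhi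
  have hsum := summable_logDeviation.sum_add_tsum_nat_add 201
  have htail0 : 0 ≤ ∑' n, logDeviation (n + 201) := tsum_nonneg fun n => logDeviation_nonneg _
  -- This is the majorant at `201`, namely `1 / (2 * 199 ^ 2)`.
  have htail : ∑' n, logDeviation (n + 201) ≤ 1 / 79202 := by
    have h := Real.tsum_le_of_sum_range_le (fun n => logDeviation_nonneg (n + 201))
      fun N => sum_logDeviation_le 201 N (by decide) (by norm_num)
    refine h.trans (le_of_eq ?_)
    rw [deviationMajorant]
    norm_num
  rw [dConst_eq, ← hsum, Real.exp_add]
  generalize ∑' n, logDeviation (n + 201) = τ at *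
  generalize Real.exp (∑ n ∈ Finset.range 201, logDeviation n) = Q at *
  have he1 : 1 ≤ Real.exp τ := Real.one_le_exp htail0
  have he2 : Real.exp τ ≤ 1.0000127 := by
    have h := (abs_le.mp (Real.abs_exp_sub_one_sub_id_le (x := τ)
      (by rw [abs_of_nonneg htail0]; linarith))).2
    have h2 : τ ^ 2 ≤ (1 / 79202) ^ 2 := pow_le_pow_left₀ htail0 htail 2
    norm_num at h2 ⊢
    linarith
  have hp1 : (3.141592 : ℝ) ^ 2 ≤ Real.pi ^ 2 :=
    pow_le_pow_left₀ (by norm_num) Real.pi_gt_d6.le 2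
  have hp2 : Real.pi ^ 2 ≤ (3.141593 : ℝ) ^ 2 :=
    pow_le_pow_left₀ Real.pi_pos.le Real.pi_lt_d6.le 2
  constructor
  · calc (0.37869 : ℝ) ≤ 3.141592 ^ 2 / 32 * (1.22782 * 1) := by norm_num
      _ ≤ _ := by gcongr
  · calc _ ≤ (3.141593 : ℝ) ^ 2 / 32 * (1.22783 * 1.0000127) := by
          have hQ : 0 ≤ Q := by linarith
          gcongr
      _ < _ := by norm_num

/-! ### The theorem -/

theorem theorem3 :
    Multipliable oddEulerFactor ∧
    ((0.37869 : ℝ) ≤ dConst ∧ dConst < (0.37870 : ℝ)) ∧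
    (∀ k : ℕ, 1 ≤ k → Summable (erdosTerm k)) ∧
    ∃ C : ℝ, ∀ k : ℕ, 1 ≤ k → ∃ E : ℝ,
      |E| ≤ C * ((k : ℝ) * Real.log ((k : ℝ) + 1)) ∧
      erdosSum k = 1 - Real.log 2 / 4 * ((2 : ℝ) ^ k)⁻¹ * (dConst * (k : ℝ) ^ 2 + E) := by
  obtain ⟨hs, C, hC⟩ := erdosSum_asymptotic
  refine ⟨Real.multipliable_of_summable_log oddEulerFactor_pos summable_log_oddEulerFactor,
    dConst_bounds, hs, C * (4 / Real.log 2), fun k hk => ?_⟩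
  have hl2 : 0 < Real.log 2 := Real.log_pos one_lt_two
  have hpow : ((2 : ℝ) ^ k)⁻¹ = (1 / 2) ^ k := by rw [one_div, inv_pow]
  have hh : (0 : ℝ) < (1 / 2) ^ k := by positivity
  have hc : 0 < Real.log 2 / 4 * (1 / 2) ^ k := by positivity
  -- The formula forces this value of `E`; dividing by `log 2 / 4 * 2 ^ (-k)` is what rescales `C`
  -- by `4 / log 2`.
  refine ⟨-((erdosSum k - (1 - Real.log 2 / 4 * (1 / 2) ^ k * (dConst * (k : ℝ) ^ 2))) /
    (Real.log 2 / 4 * (1 / 2) ^ k)), ?_, ?_⟩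
  · rw [abs_neg, abs_div, abs_of_pos hc, div_le_iff₀ hc]
    refine (hC k hk).trans (le_of_eq ?_)
    field_simp
  · rw [hpow]
    field_simp
    ring
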